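/- For a prime $p$ let $\nu_p$ denote the $p$-adic valuation on $\mathbb{Z}$, with $\nu_p(0)=\infty$. For an integer sequence $(x_n)_{n\in\mathbb{Z}}$ and a prime $p$, consider the following statement. **Conjecture $\mathcal{C}(x,p)$.** There exists a positive integer $Q$ such that for every $i\in\{0,1,\dots,Q-1\}$ at least one of the following holds. (C) There exists $\kappa_i\in\mathbb{Z}_{\ge 0}$ such that $\nu_p(x_n)=\kappa_i$ for all but finitely many $n\in\mathbb{Z}$ with $n\equiv i\pmod Q$. (L) There exist $a_i\in\mathbb{Z}$, $\kappa_i\in\mathbb{Z}$, $\mu_i\in\mathbb{Z}_{>0}$ with $\nu_p(a_i-i)\ge\nu_p(Q)$ such that $\nu_p(x_n)=\kappa_i+\mu_i\,\nu_p(n-a_i)$ for all but finitely many $n\in\mathbb{Z}$ with $n\equiv i\pmod Q$. **Theorem 1.5.** (1) Let $(x_n)_{n\in\mathbb{Z}}$ be the Tripell sequence, i.e. $x_n=2x_{n-1}+x_{n-2}+x_{n-3}$ for all $n\in\mathbb{Z}$, with $x_0=0$, $x_1=1$, $x_2=2$. Then $\mathcal{C}(x,p)$ is false for every prime $p$ with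 $5\le p\le 250$ and $p\notin\{5,19,29,41,103,137,151,191\}$, and it is true for every $p\in\{103,137,191\}$. (2) Let $(x_n)_{n\in\mathbb{Z}}$ be the modified Tripell sequence, i.e. $x_n=2x_{n-1}+2x_{n-2}+x_{n-3}$ for all $n\in\mathbb{Z}$, with $x_0=0$, $x_1=1$, $x_2=2$. Then $\mathcal{C}(x,p)$ is false for every prime $p$ with $5\le p\le 250$ and $p\notin\{5,7,23,41,83,131,193,227\}$, and it is true for every $p\in\{5,23,41,131,193,227\}$. -/

import Mathlib

namespace ThirdOrder

/-- The `p`-adic valuation of an integer, with `ν_p(0) = ∞`. The values lie in `ℤ ∪ {∞}`, so that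
they can be compared with expressions `κ + μ • ν_p(m)` in which `κ` is a possibly negative integer
(there `μ • ∞ = ∞` for `μ > 0`). -/
def nu (p : ℕ) (m : ℤ) : WithTop ℤ :=
  if m = 0 then ⊤ else (((padicValInt p m : ℕ) : ℤ) : WithTop ℤ)

/-- Option (C) for the residue class of `i` modulo `Q`: the valuation `ν_p(x_n)` is a constant
`κ ≥ 0` for all but finitely many integers `n ≡ i (mod Q)`. -/
def OptionC (x : ℤ → ℤ) (p Q i : ℕ) : Prop :=
  ∃ κ : ℕ, {n : ℤ | n ≡ i [ZMOD Q] ∧ nu p (x n) ≠ ((κ : ℤ) : WithTop ℤ)}.Finite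

/-- Option (L) for the residue class of `i` modulo `Q`: there are integers `a`, `κ` and `μ > 0`
with `ν_p(a - i) ≥ ν_p(Q)` such that `ν_p(x_n) = κ + μ ν_p(n - a)` for all but finitely many
integers `n ≡ i (mod Q)`. -/
def OptionL (x : ℤ → ℤ) (p Q i : ℕ) : Prop :=
  ∃ (a κ : ℤ) (μ : ℕ), 0 < μ ∧ nu p (Q : ℤ) ≤ nu p (a - i) ∧
    {n : ℤ | n ≡ i [ZMOD Q] ∧ nu p (x n) ≠ (κ : WithTop ℤ) + μ • nu p (n - a)}.Finite

/-- The (Marques–Lengyel) conjecture for the two-sided integer sequence `x` and the prime `p`: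
for some modulus `Q ≥ 1`, each residue class modulo `Q` satisfies (C) or (L). -/
def ConjectureHolds (x : ℤ → ℤ) (p : ℕ) : Prop :=
  ∃ Q : ℕ, 0 < Q ∧ ∀ i < Q, OptionC x p Q i ∨ OptionL x p Q i

/-- One step `(x_n, x_{n+1}, x_{n+2}) ↦ (x_{n+1}, x_{n+2}, x_{n+3})` of the recurrence
`x_{n+3} = a x_{n+2} + b x_{n+1} + x_n`. As the last coefficient is `1`, it is invertible
over `ℤ`. -/
def step (a b : ℤ) : Equiv.Perm (ℤ × ℤ × ℤ) where
  toFun t := (t.2.1, t.2.2, a * t.2.2 + b * t.2.1 + t.1)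
  invFun t := (t.2.2 - a * t.2.1 - b * t.1, t.1, t.2.1)
  left_inv t := by ext <;> simp <;> ring
  right_inv t := by ext <;> simp

/-- The two-sided sequence with `x_n = a x_{n-1} + b x_{n-2} + x_{n-3}` for all integers `n`, and
with initial values `x_0 = 0`, `x_1 = 1`, `x_2 = 2`. -/
def recSeq (a b : ℤ) (n : ℤ) : ℤ := ((step a b ^ n) (0, 1, 2)).1

/-- The Tripell sequence `x_n = 2 x_{n-1} + x_{n-2} + x_{n-3}`, `x_0 = 0`, `x_1 = 1`, `x_2 = 2`,
indexed by all integers. -/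
def tripell : ℤ → ℤ := recSeq 2 1

/-- The modified Tripell sequence `x_n = 2 x_{n-1} + 2 x_{n-2} + x_{n-3}`, `x_0 = 0`, `x_1 = 1`,
`x_2 = 2`, indexed by all integers. -/
def modifiedTripell : ℤ → ℤ := recSeq 2 2

theorem step_zpow_add_one (a b n : ℤ) (t : ℤ × ℤ × ℤ) :
    (step a b ^ (n + 1)) t = step a b ((step a b ^ n) t) := by
  rw [add_comm, zpow_add, zpow_one, Equiv.Perm.mul_apply]

theorem recSeq_add_three (a b n : ℤ) :
    recSeq a b (n + 3) = a * recSeq a b (n + 2) + b * recSeq a b (n + 1) + recSeq a b n := by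
  have h3 : n + 3 = n + 1 + 1 + 1 := by ring
  have h2 : n + 2 = n + 1 + 1 := by ring
  rw [h3, h2]
  simp only [recSeq, step_zpow_add_one]
  rfl

/-- The defining properties of the Tripell sequence. -/
theorem tripell_spec : (∀ n, tripell n =
    2 * tripell (n - 1) + tripell (n - 2) + tripell (n - 3)) ∧
    tripell 0 = 0 ∧ tripell 1 = 1 ∧ tripell 2 = 2 := by
  refine ⟨fun n => ?_, rfl, rfl, rfl⟩
  have h := recSeq_add_three 2 1 (n - 3)
  rw [show n - 3 + 3 = n by ring, show n - 3 + 2 = n - 1 by ring,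
    show n - 3 + 1 = n - 2 by ring, one_mul] at h
  exact h

/-- The defining properties of the modified Tripell sequence. -/
theorem modifiedTripell_spec : (∀ n, modifiedTripell n =
    2 * modifiedTripell (n - 1) + 2 * modifiedTripell (n - 2) + modifiedTripell (n - 3)) ∧
    modifiedTripell 0 = 0 ∧ modifiedTripell 1 = 1 ∧ modifiedTripell 2 = 2 := by
  refine ⟨fun n => ?_, rfl, rfl, rfl⟩
  have h := recSeq_add_three 2 2 (n - 3)
  rw [show n - 3 + 3 = n by ring, show n - 3 + 2 = n - 1 by ring,
    show n - 3 + 1 = n - 2 by ring] at h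
  exact h

end ThirdOrder

/-! Let U be the companion matrix and N an exponent with U ^ N ≡ 1 modulo the odd prime p. If p ^ j
divides z, then x(n + N z) ≡ x(n) + z (x(n + N) - x(n)) modulo p ^ (j + 2). Call a zero simple when
the increment x(n + N) - x(n) is not divisible by p ^ 2.

True cases. A class modulo N on which p does not divide x satisfies (C) with κ = 0; the class of a
simple integer zero c satisfies (L) with κ = μ = 1, provided p does not divide N. For the listed
primes only the classes of the zeros 0 and -1 occur. The same valuation formula shows that 0 and -1
are the only integer zeros.

False cases. A simple zero l modulo p ^ 2 lifts by Hensel to a p-adic zero. If the conjecture held,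
(C) would fail near it by unboundedness, and (L) would give an integer c ≡ l modulo p and integers n
tending p-adically to c with x(n) tending to 0. This does not immediately give x(c) = 0, because n
and c may differ modulo N. A limit E of the matrices U ^ (n - c) satisfies E ^ N = 1 and commutes
with U, so it multiplies the three conjugate terms of x(c) = y₁ + y₂ + y₃ by roots of unity, and the
twisted sum vanishes. Since one root is real and the others are complex conjugate, comparing
absolute values leaves only twists proportional to 1, z, z ^ 2 with z ^ 3 = 1
(`eq_zero_of_twisted_sum_eq_zero`). Primitive z is excluded arithmetically, so x(c) = 0 and c is 0
or -1. The tabulated l is congruent to neither modulo p. -/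

namespace ThirdOrder

/-! ### Powers of elements congruent to 1 modulo p -/

theorem exists_one_add_pow_eq {R : Type*} [CommRing R] (y : R) (n : ℕ) :
    ∃ k : R, (1 + y) ^ n = 1 + n * y + (n.choose 2 : ℕ) * y ^ 2 + k * y ^ 3 := by
  induction n with
  | zero => exact ⟨0, by simp⟩
  | succ n ih =>
    obtain ⟨k, hk⟩ := ih
    refine ⟨k + (n.choose 2 : ℕ) + k * y, ?_⟩
    rw [pow_succ, hk, Nat.choose_succ_succ' n 1, Nat.choose_one_right]
    push_cast
    ring

/-- First-order expansion of a natural power of `1 + p y`, with an error term governed by the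
`p`-adic valuation of the exponent. -/
theorem exists_one_add_mul_pow_eq {R : Type*} [CommRing R] {p : ℕ} (hp : p.Prime) (hp2 : p ≠ 2)
    (y : R) (j m : ℕ) :
    ∃ c : R, (1 + p * y) ^ (p ^ j * m) = 1 + p * ((p ^ j * m : ℕ) : R) * y + p ^ (j + 2) * c := by
  induction j with
  | zero =>
    obtain ⟨k, hk⟩ := exists_one_add_pow_eq ((p : R) * y) m
    refine ⟨(m.choose 2 : ℕ) * y ^ 2 + k * y ^ 3 * p, ?_⟩
    rw [pow_zero, one_mul, hk]
    push_cast
    ring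
  | succ j ih =>
    obtain ⟨c, hc⟩ := ih
    -- Oddness of p enters here: p divides `p.choose 2`, so the quadratic term is divisible by p ^
    -- (j + 3).
    obtain ⟨q, hq⟩ := hp.dvd_choose_self (k := 2) (by norm_num)
      (lt_of_le_of_ne hp.two_le (Ne.symm hp2))
    obtain ⟨k, hk⟩ := exists_one_add_pow_eq ((p : R) ^ (j + 1) * (m * y + p * c)) p
    refine ⟨c + q * p ^ j * (m * y + p * c) ^ 2 + k * p ^ (2 * j) * (m * y + p * c) ^ 3, ?_⟩
    have e : p ^ (j + 1) * m = p ^ j * m * p := by ring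
    rw [e, pow_mul, hc]
    have e2 : (1 : R) + p * ((p ^ j * m : ℕ) : R) * y + p ^ (j + 2) * c
        = 1 + p ^ (j + 1) * (m * y + p * c) := by
      push_cast
      ring
    rw [e2, hk, hq]
    push_cast
    ring

/-- Only powers of the single element B occur, so evaluating an identity of ℤ[X] at B covers
noncommutative rings. -/
theorem exists_one_add_mul_pow_eq' {R : Type*} [Ring R] {p : ℕ} (hp : p.Prime) (hp2 : p ≠ 2)
    (B : R) (j z : ℕ) (hz : p ^ j ∣ z) :
    ∃ c : R, (1 + p * B) ^ z = 1 + p * (z : R) * B + p ^ (j + 2) * c := by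
  obtain ⟨m, rfl⟩ := hz
  obtain ⟨c, hc⟩ := exists_one_add_mul_pow_eq hp hp2 (Polynomial.X : Polynomial ℤ) j m
  refine ⟨Polynomial.aeval B c, ?_⟩
  have := congrArg (Polynomial.aeval B) hc
  simpa using this

/-- First-order expansion of an integer power of a unit congruent to `1` modulo `p`. -/
theorem exists_units_zpow_eq {R : Type*} [Ring R] {p : ℕ} (hp : p.Prime) (hp2 : p ≠ 2)
    (u : Rˣ) (B : R) (hu : (u : R) = 1 + p * B) (j : ℕ) (z : ℤ) (hz : (p : ℤ) ^ j ∣ z) :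
    ∃ c : R, ((u ^ z : Rˣ) : R) = 1 + p * (z : R) * B + p ^ (j + 2) * c := by
  obtain ⟨z, rfl | rfl⟩ := z.eq_nat_or_neg
  · obtain ⟨c, hc⟩ := exists_one_add_mul_pow_eq' hp hp2 B j z (by exact_mod_cast hz)
    exact ⟨c, by rw [zpow_natCast, Units.val_pow_eq_pow_val, hu, hc]; simp⟩
  · set w : R := ((u⁻¹ : Rˣ) : R) with hw
    -- The inverse w is again 1 modulo p, with -B w in place of B. As w ≡ 1, replacing B w by B
    -- costs one more factor p, which the error term absorbs.
    have hw1 : w = 1 + p * (-(B * w)) := by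
      have : (u : R) * w = 1 := u.mul_inv
      rw [hu] at this
      rw [← this]
      noncomm_ring
    have hz' : p ^ j ∣ z := by
      have := (dvd_neg (α := ℤ)).1 hz
      exact_mod_cast this
    obtain ⟨c, hc⟩ := exists_one_add_mul_pow_eq' hp hp2 (-(B * w)) j z hz'
    obtain ⟨m, rfl⟩ := hz'
    refine ⟨c + m * (B * (B * w)), ?_⟩
    have e1 : -(B * w) = -B + p * (B * (B * w)) := by
      conv_lhs => rw [hw1]
      have : B * ((p : R) * -(B * w)) = (p : R) * (B * -(B * w)) := by
        rw [← mul_assoc, ← (Nat.cast_commute p B).eq, mul_assoc]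
      rw [mul_add, this]
      noncomm_ring
    rw [zpow_neg, zpow_natCast, ← inv_pow, Units.val_pow_eq_pow_val, ← hw]
    conv_lhs => rw [hw1]
    rw [hc, e1]
    have key : (p : R) * ((p ^ j * m : ℕ) : R) * (p * (B * (B * w)))
        = p ^ (j + 2) * (m * (B * (B * w))) := by
      have : (p : R) * ((p ^ j * m : ℕ) : R) * p = p ^ (j + 2) * m := by
        exact_mod_cast congrArg (Nat.cast (R := R)) (by ring : p * (p ^ j * m) * p = p ^ (j + 2) * m)
      rw [← mul_assoc, this, mul_assoc]
    rw [mul_add, key, mul_add]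
    push_cast
    noncomm_ring

/-! ### Companion matrix, periods modulo p and first-order expansion of the sequence -/

/-- The companion matrix of `X ^ 3 - a X ^ 2 - b X - 1`, as a unit. -/
def companion (a b : ℤ) : (Matrix (Fin 3) (Fin 3) ℤ)ˣ where
  val := !![0, 1, 0; 0, 0, 1; 1, b, a]
  inv := !![-b, -a, 1; 1, 0, 0; 0, 1, 0]
  val_inv := by
    ext i j
    fin_cases i <;> fin_cases j <;> simp [Matrix.mul_apply, Fin.sum_univ_three]
  inv_val := by
    ext i j
    fin_cases i <;> fin_cases j <;> simp [Matrix.mul_apply, Fin.sum_univ_three]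

theorem recSeq_sub_one (a b n : ℤ) :
    recSeq a b (n - 1) = recSeq a b (n + 2) - a * recSeq a b (n + 1) - b * recSeq a b n := by
  have := recSeq_add_three a b (n - 1)
  rw [show n - 1 + 3 = n + 2 by ring, show n - 1 + 2 = n + 1 by ring,
    show n - 1 + 1 = n by ring] at this
  linarith

/-- Three consecutive terms of the sequence. -/
def state (a b n : ℤ) : Fin 3 → ℤ := ![recSeq a b n, recSeq a b (n + 1), recSeq a b (n + 2)]

theorem companion_mulVec_state (a b n : ℤ) :
    (companion a b).val.mulVec (state a b n) = state a b (n + 1) := by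
  ext i
  have := recSeq_add_three a b n
  fin_cases i <;>
    simp [companion, state, Matrix.mulVec, dotProduct, Fin.sum_univ_three, add_assoc] <;>
    linarith

theorem companion_inv_mulVec_state (a b n : ℤ) :
    (companion a b)⁻¹.val.mulVec (state a b n) = state a b (n - 1) := by
  have h := companion_mulVec_state a b (n - 1)
  rw [sub_add_cancel] at h
  rw [← h, Matrix.mulVec_mulVec, Units.inv_mul, Matrix.one_mulVec]

theorem companion_zpow_mulVec_state (a b n m : ℤ) :
    ((companion a b) ^ m).val.mulVec (state a b n) = state a b (n + m) := by
  induction m with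
  | zero => simp
  | succ m ih =>
    rw [add_comm (m : ℤ) 1, zpow_add, zpow_one, Units.val_mul, ← Matrix.mulVec_mulVec, ih,
      companion_mulVec_state]
    congr 1
    ring
  | pred m ih =>
    rw [sub_eq_add_neg, add_comm (-(m : ℤ)) (-1), zpow_add, zpow_neg_one, Units.val_mul,
      ← Matrix.mulVec_mulVec, ih, companion_inv_mulVec_state]
    congr 1
    ring

/-- The companion matrix satisfies `U ^ N ≡ 1` modulo `p`. -/
def IsPeriodMod (a b : ℤ) (p N : ℕ) : Prop :=
  ∃ B : Matrix (Fin 3) (Fin 3) ℤ, ((companion a b) ^ N).val = 1 + p * B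

theorem IsPeriodMod.exists_zpow_eq {a b : ℤ} {p N : ℕ} (h : IsPeriodMod a b p N) (hp : p.Prime)
    (hp2 : p ≠ 2) : ∃ B : Matrix (Fin 3) (Fin 3) ℤ, ∀ (j : ℕ) (z : ℤ), (p : ℤ) ^ j ∣ z →
      ∃ C : Matrix (Fin 3) (Fin 3) ℤ, ((companion a b) ^ (N * z : ℤ)).val =
        1 + p * (z : Matrix (Fin 3) (Fin 3) ℤ) * B + p ^ (j + 2) * C := by
  obtain ⟨B, hB⟩ := h
  refine ⟨B, fun j z hz => ?_⟩
  obtain ⟨c, hc⟩ := exists_units_zpow_eq hp hp2 _ B hB j z hz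
  exact ⟨c, by rw [zpow_mul, zpow_natCast, hc]⟩

theorem IsPeriodMod.mul {a b : ℤ} {p N : ℕ} (h : IsPeriodMod a b p N) (q : ℕ) :
    IsPeriodMod a b p (N * q) := by
  obtain ⟨B, hB⟩ := h
  induction q with
  | zero => exact ⟨0, by simp⟩
  | succ q ih =>
    obtain ⟨C, hC⟩ := ih
    refine ⟨C + B + C * p * B, ?_⟩
    rw [mul_add, mul_one, pow_add, Units.val_mul, hC, hB]
    noncomm_ring

/-- First-order expansion of `z ↦ x (n + N z)` modulo powers of `p`. -/
theorem IsPeriodMod.dvd_sub {a b : ℤ} {p N : ℕ} (h : IsPeriodMod a b p N) (hp : p.Prime)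
    (hp2 : p ≠ 2) (n z : ℤ) (j : ℕ) (hz : (p : ℤ) ^ j ∣ z) :
    (p : ℤ) ^ (j + 2) ∣ recSeq a b (n + N * z) - recSeq a b n
      - z * (recSeq a b (n + N) - recSeq a b n) := by
  have key : ∃ y : ℤ, ∀ (j : ℕ) (z : ℤ), (p : ℤ) ^ j ∣ z → ∃ c : ℤ,
      recSeq a b (n + N * z) = recSeq a b n + p * z * y + p ^ (j + 2) * c := by
    obtain ⟨B, hB⟩ := h.exists_zpow_eq hp hp2
    refine ⟨(B.mulVec (state a b n)) 0, fun j z hz => ?_⟩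
    obtain ⟨C, hC⟩ := hB j z hz
    refine ⟨(C.mulVec (state a b n)) 0, ?_⟩
    have h1 := congrFun (companion_zpow_mulVec_state a b n (N * z)) 0
    have e1 : (p * (z : Matrix (Fin 3) (Fin 3) ℤ) * B) = ((p * z : ℤ)) • B := by
      rw [zsmul_eq_mul]; push_cast; rfl
    have e2 : ((p : Matrix (Fin 3) (Fin 3) ℤ) ^ (j + 2) * C) = ((p : ℤ) ^ (j + 2)) • C := by
      rw [zsmul_eq_mul]; push_cast; rfl
    rw [hC, e1, e2, Matrix.add_mulVec, Matrix.add_mulVec, Matrix.one_mulVec, Matrix.smul_mulVec,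
      Matrix.smul_mulVec] at h1
    simpa only [state, Pi.add_apply, Pi.smul_apply, smul_eq_mul, Matrix.cons_val_zero] using h1.symm
  obtain ⟨y, hy⟩ := key
  obtain ⟨c, hc⟩ := hy j z hz
  -- The case z = 1 identifies p y with the increment x(n + N) - x(n) up to p ^ 2; after
  -- multiplication by z this error is divisible by p ^ (j + 2).
  obtain ⟨c', hc'⟩ := hy 0 1 (one_dvd _)
  obtain ⟨m, rfl⟩ := hz
  rw [mul_one] at hc'
  refine ⟨c - m * c', ?_⟩
  rw [hc, hc']
  ring

theorem IsPeriodMod.dvd_sub_self {a b : ℤ} {p N : ℕ} (h : IsPeriodMod a b p N) (n : ℤ) :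
    (p : ℤ) ∣ recSeq a b (n + N) - recSeq a b n := by
  obtain ⟨B, hB⟩ := h
  refine ⟨(B.mulVec (state a b n)) 0, ?_⟩
  have h1 := congrFun (companion_zpow_mulVec_state a b n N) 0
  have e1 : (p * B) = (p : ℤ) • B := by
    rw [zsmul_eq_mul]; push_cast; rfl
  rw [zpow_natCast, hB, e1, Matrix.add_mulVec, Matrix.one_mulVec, Matrix.smul_mulVec] at h1
  simp only [state, Pi.add_apply, Pi.smul_apply, smul_eq_mul, Matrix.cons_val_zero] at h1
  rw [state, ← h1]
  ring

theorem IsPeriodMod.dvd_sub_of_modEq {a b : ℤ} {p N : ℕ} (h : IsPeriodMod a b p N) (hp : p.Prime)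
    (hp2 : p ≠ 2) (n z : ℤ) : (p : ℤ) ∣ recSeq a b (n + N * z) - recSeq a b n := by
  have h1 := h.dvd_sub hp hp2 n z 0 (one_dvd _)
  have h2 := (h.dvd_sub_self n).mul_left z
  have h3 := ((dvd_pow_self (p : ℤ) (by norm_num : 0 + 2 ≠ 0)).trans h1).add h2
  simpa using h3

/-- The increments `x (n + N) - x n` depend modulo `p ^ 2` only on `n` modulo `N`. -/
theorem IsPeriodMod.sq_dvd_sub {a b : ℤ} {p N : ℕ} (h : IsPeriodMod a b p N) (hp : p.Prime)
    (hp2 : p ≠ 2) (n z : ℤ) : (p : ℤ) ^ 2 ∣ recSeq a b (n + N * z + N) - recSeq a b (n + N * z)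
      - (recSeq a b (n + N) - recSeq a b n) := by
  have h1 := h.dvd_sub hp hp2 n z 0 (one_dvd _)
  have h2 := h.dvd_sub hp hp2 n (z + 1) 0 (one_dvd _)
  rw [show n + N * z + N = n + N * (z + 1) by ring]
  have h3 := h2.sub h1
  rw [zero_add] at h3
  refine (dvd_of_eq rfl).trans (h3.trans (dvd_of_eq ?_))
  ring

/-! ### Valuations near simple zeros; the true cases and the integer zeros -/

theorem nu_pow_mul {p : ℕ} (hp : p.Prime) (j : ℕ) (u : ℤ) (hu : ¬ (p : ℤ) ∣ u) :
    nu p ((p : ℤ) ^ j * u) = ((j : ℤ) : WithTop ℤ) := by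
  have := Fact.mk hp
  have hu0 : u ≠ 0 := by rintro rfl; exact hu (dvd_zero _)
  have hp0 : (p : ℤ) ^ j ≠ 0 := pow_ne_zero _ (by exact_mod_cast hp.ne_zero)
  rw [nu, if_neg (mul_ne_zero hp0 hu0), padicValInt.mul hp0 hu0,
    padicValInt.eq_zero_of_not_dvd hu, add_zero]
  congr 2
  rw [← Nat.cast_pow, padicValInt.of_nat, padicValNat.prime_pow]

theorem le_nu_iff {p : ℕ} (hp : p.Prime) (k : ℕ) (m : ℤ) :
    ((k : ℤ) : WithTop ℤ) ≤ nu p m ↔ (p : ℤ) ^ k ∣ m := by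
  have := Fact.mk hp
  rw [nu, padicValInt_dvd_iff]
  split_ifs with h
  · simp [h]
  · simp only [h, false_or]
    rw [WithTop.coe_le_coe, Int.ofNat_le]

theorem exists_eq_pow_mul_and_not_dvd {p : ℕ} (hp : p.Prime) {z : ℤ} (hz : z ≠ 0) :
    ∃ (j : ℕ) (u : ℤ), ¬ (p : ℤ) ∣ u ∧ z = (p : ℤ) ^ j * u := by
  have hf : FiniteMultiplicity (p : ℤ) z :=
    Int.finiteMultiplicity_iff.2 ⟨by simpa using hp.ne_one, hz⟩
  obtain ⟨u, hu, hpu⟩ := hf.exists_eq_pow_mul_and_not_dvd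
  exact ⟨_, u, hpu, hu⟩

/-- Near a simple zero `c` the valuation of `x n` is determined by that of `n - c`. -/
theorem IsPeriodMod.nu_eq {a b : ℤ} {p N : ℕ} (h : IsPeriodMod a b p N) (hp : p.Prime)
    (hp2 : p ≠ 2) (hN : ¬ p ∣ N) {c : ℤ} (hc : recSeq a b c = 0)
    (hc2 : ¬ (p : ℤ) ^ 2 ∣ recSeq a b (c + N)) (z : ℤ) :
    nu p (recSeq a b (c + N * z)) = ((1 : ℤ) : WithTop ℤ) + nu p (N * z) := by
  have hpZ : Prime (p : ℤ) := Nat.prime_iff_prime_int.1 hp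
  rcases eq_or_ne z 0 with rfl | hz
  · simp [hc, nu]
  obtain ⟨j, u, hu, rfl⟩ := exists_eq_pow_mul_and_not_dvd hp hz
  obtain ⟨e, he⟩ := h.dvd_sub hp hp2 c ((p : ℤ) ^ j * u) j (dvd_mul_right _ _)
  obtain ⟨d, hd⟩ := h.dvd_sub_self c
  rw [hc, sub_zero] at hd
  rw [hc, sub_zero, sub_zero] at he
  have hpd : ¬ (p : ℤ) ∣ d := by
    rintro ⟨d', rfl⟩
    exact hc2 ⟨d', by rw [hd]; ring⟩
  -- Here x(c + N) = p d with d prime to p, so the linear term has valuation exactly j + 1 and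
  -- dominates the error.
  have e1 : recSeq a b (c + N * ((p : ℤ) ^ j * u)) = (p : ℤ) ^ (j + 1) * (u * d + p * e) := by
    rw [hd] at he
    linear_combination he
  have hnd : ¬ (p : ℤ) ∣ u * d + p * e := by
    rw [Int.dvd_add_left (dvd_mul_right _ _)]
    exact fun h => (hpZ.dvd_or_dvd h).elim hu hpd
  have hnd' : ¬ (p : ℤ) ∣ N * u := fun h =>
    (hpZ.dvd_or_dvd h).elim (fun h => hN (by exact_mod_cast h)) hu
  rw [e1, nu_pow_mul hp _ _ hnd, show (N : ℤ) * ((p : ℤ) ^ j * u) = (p : ℤ) ^ j * (N * u) by ring,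
    nu_pow_mul hp _ _ hnd', ← WithTop.coe_add]
  push_cast
  rw [add_comm]

theorem recSeq_zero (a b : ℤ) : recSeq a b 0 = 0 := rfl

theorem recSeq_neg_one (b : ℤ) : recSeq 2 b (-1) = 0 := by
  have := recSeq_sub_one 2 b 0
  norm_num at this
  rw [this]
  simp [show recSeq 2 b 2 = 2 from rfl, show recSeq 2 b 1 = 1 from rfl,
    show recSeq 2 b 0 = 0 from rfl]

/-- Modulo `p` the sequence vanishes only along the classes of `0` and `-1` modulo the
period `N`, and these two zeros are simple. -/
structure OnlyTrivialZeros (b : ℤ) (p N : ℕ) : Prop where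
  prime : p.Prime
  ne_two : p ≠ 2
  period : IsPeriodMod 2 b p N
  not_dvd : ¬ p ∣ N
  zero : ¬ (p : ℤ) ^ 2 ∣ recSeq 2 b (0 + N)
  neg_one : ¬ (p : ℤ) ^ 2 ∣ recSeq 2 b (-1 + N)
  other : ∀ i < N, i = 0 ∨ i + 1 = N ∨ ¬ (p : ℤ) ∣ recSeq 2 b i

theorem OnlyTrivialZeros.pos {b : ℤ} {p N : ℕ} (h : OnlyTrivialZeros b p N) : 0 < N :=
  Nat.pos_of_ne_zero fun h0 => h.not_dvd (h0 ▸ dvd_zero p)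

theorem nu_eq_zero {p : ℕ} (hp : p.Prime) {m : ℤ} (h : ¬ (p : ℤ) ∣ m) :
    nu p m = ((0 : ℕ) : ℤ) := by
  simpa using nu_pow_mul hp 0 m h

theorem OnlyTrivialZeros.conjectureHolds {b : ℤ} {p N : ℕ} (h : OnlyTrivialZeros b p N) :
    ConjectureHolds (recSeq 2 b) p := by
  have key : ∀ (c : ℤ) (i : ℕ), recSeq 2 b c = 0 → ¬ (p : ℤ) ^ 2 ∣ recSeq 2 b (c + N) →
      c ≡ i [ZMOD N] → OptionL (recSeq 2 b) p N i := by
    intro c i hc hc2 hci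
    refine ⟨c, 1, 1, one_pos, ?_, ?_⟩
    -- The modulus N is prime to p, so the condition on a only asks for a nonnegative valuation.
    · rw [nu_eq_zero h.prime (by exact_mod_cast h.not_dvd), le_nu_iff h.prime]
      simp
    · convert Set.finite_empty
      rw [Set.eq_empty_iff_forall_notMem]
      rintro n ⟨hn, hne⟩
      obtain ⟨z, hz⟩ := (hci.trans hn.symm).dvd
      apply hne
      have := h.period.nu_eq h.prime h.ne_two h.not_dvd hc hc2 z
      rw [← hz, show c + (n - c) = n by ring] at this
      rw [this, one_smul]
  refine ⟨N, h.pos, fun i hi => ?_⟩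
  rcases h.other i hi with rfl | hi' | hi'
  · exact .inr (key 0 0 rfl h.zero rfl)
  · refine .inr (key (-1) i (recSeq_neg_one b) h.neg_one ?_)
    rw [Int.modEq_iff_dvd]
    exact ⟨1, by rw [← hi']; push_cast; ring⟩
  · refine .inl ⟨0, ?_⟩
    convert Set.finite_empty
    rw [Set.eq_empty_iff_forall_notMem]
    rintro n ⟨hn, hne⟩
    obtain ⟨z, hz⟩ := hn.symm.dvd
    apply hne
    apply nu_eq_zero h.prime
    have := h.period.dvd_sub_of_modEq h.prime h.ne_two i z
    rw [← hz, show (i : ℤ) + (n - i) = n by ring] at this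
    rwa [dvd_iff_dvd_of_dvd_sub this]

/-- The valuation formula around a simple zero is finite away from it, so each of the two vanishing
classes contains just one integer zero. One suitable prime thus settles all integer zeros. -/
theorem OnlyTrivialZeros.eq_of_eq_zero {b : ℤ} {p N : ℕ} (h : OnlyTrivialZeros b p N) {n : ℤ}
    (hn : recSeq 2 b n = 0) : n = 0 ∨ n = -1 := by
  have hpos : (0 : ℤ) < N := by exact_mod_cast h.pos
  have key : ∀ c z : ℤ, recSeq 2 b c = 0 → ¬ (p : ℤ) ^ 2 ∣ recSeq 2 b (c + N) →
      n = c + N * z → n = c := by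
    intro c z hc hc2 hz
    have h1 := h.period.nu_eq h.prime h.ne_two h.not_dvd hc hc2 z
    rw [← hz, hn] at h1
    by_contra hne
    have hz0 : (N : ℤ) * z ≠ 0 := fun h0 => hne (by rw [hz, h0, add_zero])
    rw [nu, nu, if_pos rfl, if_neg hz0, ← WithTop.coe_add] at h1
    exact WithTop.coe_ne_top h1.symm
  obtain ⟨i, hi⟩ := Int.eq_ofNat_of_zero_le (Int.emod_nonneg n hpos.ne')
  have hiN : i < N := by
    have := Int.emod_lt_of_pos n hpos
    rw [hi] at this
    exact_mod_cast this
  have hn' : n = i + N * (n / N) := by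
    have := Int.emod_add_mul_ediv n N
    rw [hi] at this
    exact this.symm
  rcases h.other i hiN with rfl | hi' | hi'
  · exact .inl (key 0 _ rfl h.zero (by simpa using hn'))
  · refine .inr (key (-1) (n / N + 1) (recSeq_neg_one b) h.neg_one ?_)
    rw [← hi'] at hn' ⊢
    push_cast at hn' ⊢
    linear_combination hn'
  · exfalso
    have := h.period.dvd_sub_of_modEq h.prime h.ne_two i (n / N)
    rw [← hn', hn, zero_sub, dvd_neg] at this
    exact hi' this

/-! ### Hensel lifting and the consequence of the conjecture at a simple zero -/

/-- One Newton step. The increment modulo p ^ 2 depends only on the class modulo N, so simplicity of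
l passes to n. -/
theorem IsPeriodMod.exists_lift {a b : ℤ} {p N : ℕ} (h : IsPeriodMod a b p N) (hp : p.Prime)
    (hp2 : p ≠ 2) {l : ℤ} (hl : (p : ℤ) ^ 2 ∣ recSeq a b l)
    (hl2 : ¬ (p : ℤ) ^ 2 ∣ recSeq a b (l + N)) (k : ℕ) (n : ℤ) (hnl : (N : ℤ) ∣ n - l)
    (hn : (p : ℤ) ^ (k + 2) ∣ recSeq a b n) :
    ∃ n' : ℤ, (N : ℤ) * (p : ℤ) ^ (k + 1) ∣ n' - n ∧ (p : ℤ) ^ (k + 3) ∣ recSeq a b n' := by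
  obtain ⟨w, hw⟩ := hnl
  obtain rfl : n = l + N * w := by linear_combination hw
  obtain ⟨d, hd⟩ := h.dvd_sub_self (l + N * w)
  have hpd : ¬ (p : ℤ) ∣ d := by
    rintro ⟨d', rfl⟩
    apply hl2
    have h1 := h.sq_dvd_sub hp hp2 l w
    rw [hd, show (p : ℤ) * (p * d') = p ^ 2 * d' by ring,
      dvd_sub_right (dvd_mul_right _ _)] at h1
    simpa using h1.add hl
  obtain ⟨x, hx⟩ := hn
  obtain ⟨s, t, hst⟩ : IsCoprime d (p : ℤ) :=
    ((Nat.prime_iff_prime_int.1 hp).irreducible.coprime_iff_not_dvd.2 hpd).symm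
  -- With x(n) = p ^ (k + 2) x and s the inverse of d modulo p, this shift cancels the leading term.
  refine ⟨l + N * w + N * (p ^ (k + 1) * (-s * x)), ⟨-s * x, by ring⟩, ?_⟩
  obtain ⟨e, he⟩ := h.dvd_sub hp hp2 (l + N * w) (p ^ (k + 1) * (-s * x)) (k + 1)
    (dvd_mul_right _ _)
  rw [hd, hx] at he
  refine ⟨e + t * x, ?_⟩
  linear_combination he - (p : ℤ) ^ (k + 2) * x * hst

/-- Hensel lifting of a simple zero modulo `p ^ 2` to a coherent sequence of zeros modulo powers
of `p`. -/
theorem IsPeriodMod.exists_seq {a b : ℤ} {p N : ℕ} (h : IsPeriodMod a b p N) (hp : p.Prime)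
    (hp2 : p ≠ 2) {l : ℤ} (hl : (p : ℤ) ^ 2 ∣ recSeq a b l)
    (hl2 : ¬ (p : ℤ) ^ 2 ∣ recSeq a b (l + N)) :
    ∃ m : ℕ → ℤ, m 0 = l ∧ (∀ k, (N : ℤ) * (p : ℤ) ^ (k + 1) ∣ m (k + 1) - m k) ∧
      ∀ k, (p : ℤ) ^ (k + 2) ∣ recSeq a b (m k) := by
  have := h.exists_lift hp hp2 hl hl2
  choose! f hf1 hf2 using this
  let m : ℕ → ℤ := fun k => Nat.rec l f k
  have hm : ∀ k, (N : ℤ) ∣ m k - l ∧ (p : ℤ) ^ (k + 2) ∣ recSeq a b (m k) := by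
    intro k
    induction k with
    | zero => exact ⟨by simp [m], hl⟩
    | succ k ih =>
      refine ⟨?_, hf2 k _ ih.1 ih.2⟩
      have := (dvd_of_mul_right_dvd (hf1 k _ ih.1 ih.2)).add ih.1
      simpa [m] using this
  exact ⟨m, rfl, fun k => hf1 k _ (hm k).1 (hm k).2, fun k => (hm k).2⟩

/-- If the conjecture holds then every simple `p`-adic zero is approximated by an integer. -/
theorem IsPeriodMod.exists_int_of_conjectureHolds {a b : ℤ} {p N : ℕ} (h : IsPeriodMod a b p N)
    (hp : p.Prime) (hp2 : p ≠ 2) {l : ℤ} (hl : (p : ℤ) ^ 2 ∣ recSeq a b l)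
    (hl2 : ¬ (p : ℤ) ^ 2 ∣ recSeq a b (l + N)) (hC : ConjectureHolds (recSeq a b) p) :
    ∃ c : ℤ, (p : ℤ) ∣ c - l ∧
      ∀ K : ℕ, ∃ n : ℤ, (p : ℤ) ^ K ∣ n - c ∧ (p : ℤ) ^ K ∣ recSeq a b n := by
  obtain ⟨Q, hQ, hC⟩ := hC
  obtain ⟨e, q, hpq, rfl⟩ := Nat.exists_eq_pow_mul_and_not_dvd hQ.ne' p hp.ne_one
  have hpZ := Nat.prime_iff_prime_int.1 hp
  have hl2' : ¬ (p : ℤ) ^ 2 ∣ recSeq a b (l + (N * q : ℕ)) := by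
    -- Since q is prime to p, the zero stays simple for the period N q. Lifting with this period
    -- keeps the approximations in one class modulo Q once k ≥ e.
    intro h1
    have h2 := h.dvd_sub hp hp2 l q 0 (one_dvd _)
    rw [zero_add] at h2
    push_cast at h1
    rw [dvd_sub_right (h1.sub hl)] at h2
    have hcop : IsCoprime ((p : ℤ) ^ 2) q :=
      (hpZ.irreducible.coprime_iff_not_dvd.2 (by exact_mod_cast hpq)).pow_left
    have := hcop.dvd_of_dvd_mul_left h2
    exact hl2 (by simpa using this.add hl)
  have h' := h.mul q
  obtain ⟨m, hm0, hm, hx⟩ := h'.exists_seq hp hp2 hl hl2'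
  generalize hN' : N * q = N' at *
  have hmk : ∀ k r, (N' : ℤ) * (p : ℤ) ^ (k + 1) ∣ m (k + r) - m k := by
    intro k r
    induction r with
    | zero => simp
    | succ r ih =>
      have h1 : (N' : ℤ) * (p : ℤ) ^ (k + 1) ∣ m (k + r + 1) - m (k + r) :=
        (mul_dvd_mul_left _ (pow_dvd_pow _ (by lia))).trans (hm (k + r))
      simpa [add_assoc] using h1.add ih
  -- A whole residue class consists of zeros modulo p ^ (k + 2), so any finite exceptional set can
  -- be avoided.
  have hall : ∀ k (s : ℤ), (p : ℤ) ^ (k + 2) ∣ recSeq a b (m k + N' * (p ^ (k + 1) * s)) := by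
    intro k s
    have h1 := h'.dvd_sub hp hp2 (m k) (p ^ (k + 1) * s) (k + 1) (dvd_mul_right _ _)
    obtain ⟨d, hd⟩ := h'.dvd_sub_self (m k)
    have h2 := (pow_dvd_pow (p : ℤ) (by lia : k + 2 ≤ k + 1 + 2)).trans h1
    rw [hd, dvd_sub_left ⟨s * d, by ring⟩] at h2
    simpa using h2.add (hx k)
  have hQpos : (0 : ℤ) < (p ^ e * q : ℕ) := by exact_mod_cast hQ
  obtain ⟨i, hi⟩ := Int.eq_ofNat_of_zero_le (Int.emod_nonneg (m e) hQpos.ne')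
  have hiQ : i < p ^ e * q := by
    have := Int.emod_lt_of_pos (m e) hQpos
    rw [hi] at this
    exact_mod_cast this
  have hmi : m e ≡ i [ZMOD (p ^ e * q : ℕ)] := by
    rw [← Int.ofNat_eq_natCast, ← hi]
    exact (Int.mod_modEq _ _).symm
  have hsel : ∀ (S : Set ℤ), S.Finite → ∀ k, ∃ n, n ∉ S ∧ n ≡ i [ZMOD (p ^ e * q : ℕ)] ∧
      (p : ℤ) ∣ n - l ∧ (p : ℤ) ^ (k + 2) ∣ recSeq a b n := by
    intro S hS k
    have hN0 : (N' : ℤ) ≠ 0 := by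
      rintro h0
      rw [h0, add_zero] at hl2'
      exact hl2' hl
    have hp0 : (p : ℤ) ^ (e + k + 1) ≠ 0 := pow_ne_zero _ hpZ.ne_zero
    have hinj : Function.Injective fun s : ℤ => m (e + k) + N' * (p ^ (e + k + 1) * s) := by
      intro s t hst
      have hst' : m (e + k) + N' * (p ^ (e + k + 1) * s) = m (e + k) + N' * (p ^ (e + k + 1) * t) :=
        hst
      exact mul_left_cancel₀ hp0 (mul_left_cancel₀ hN0 (add_left_cancel hst'))
    obtain ⟨n, ⟨s, rfl⟩, hnS⟩ := (Set.infinite_range_of_injective hinj).exists_notMem_finite hS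
    have h1 : (N' : ℤ) * p ^ (e + 1) ∣ m (e + k) + N' * (p ^ (e + k + 1) * s) - m e := by
      have h2 := hmk e k
      have h3 : (N' : ℤ) * p ^ (e + 1) ∣ N' * (p ^ (e + k + 1) * s) :=
        mul_dvd_mul_left _ ((pow_dvd_pow _ (by lia)).mul_right s)
      rw [add_sub_right_comm]
      exact h2.add h3
    have h0 : (N' : ℤ) * p ∣ m (e + k) + N' * (p ^ (e + k + 1) * s) - l := by
      have h2 := hmk 0 e
      rw [zero_add, zero_add, pow_one, hm0] at h2
      have h3 := (mul_dvd_mul_left (N' : ℤ) (dvd_pow_self (p : ℤ) (Nat.succ_ne_zero e))).trans h1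
      simpa using h3.add h2
    refine ⟨_, hnS, ?_, dvd_of_mul_left_dvd h0,
      (pow_dvd_pow _ (by lia)).trans (hall (e + k) s)⟩
    refine Int.ModEq.trans ?_ hmi
    refine (Int.modEq_iff_dvd.2 (dvd_trans ?_ h1)).symm
    rw [← hN']
    exact ⟨N * p, by push_cast; ring⟩
  rcases hC i hiQ with ⟨κ, hκ⟩ | ⟨c, κ, μ, hμ, -, hκ⟩
  · exfalso
    obtain ⟨n, hn, hni, -, hxn⟩ := hsel _ hκ κ
    have h1 : nu p (recSeq a b n) = ((κ : ℤ) : WithTop ℤ) := by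
      by_contra h
      exact hn ⟨hni, h⟩
    have h2 := (le_nu_iff hp _ _).2 hxn
    rw [h1, WithTop.coe_le_coe] at h2
    lia
  · have key : ∀ K : ℕ, ∃ n : ℤ, (p : ℤ) ∣ n - l ∧ (p : ℤ) ^ K ∣ n - c ∧
        (p : ℤ) ^ K ∣ recSeq a b n := by
      intro K
      -- If the valuation of n - c were below K, then (L) would bound that of x(n) by |κ| + μ K. The
      -- extra K also gives p ^ K ∣ x(n).
      obtain ⟨n, hn, hni, hnp, hxn⟩ := hsel _ hκ (κ.natAbs + μ * K + K)
      refine ⟨n, hnp, ?_, (pow_dvd_pow _ (by lia)).trans hxn⟩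
      have h1 : nu p (recSeq a b n) = κ + μ • nu p (n - c) := by
        by_contra h
        exact hn ⟨hni, h⟩
      have h2 := (le_nu_iff hp _ _).2 hxn
      rw [h1] at h2
      rcases eq_or_ne (n - c) 0 with h0 | h0
      · simp [h0]
      obtain ⟨j, u, hu, hj⟩ := exists_eq_pow_mul_and_not_dvd hp h0
      rw [hj, nu_pow_mul hp j u hu, ← WithTop.coe_nsmul, ← WithTop.coe_add,
        WithTop.coe_le_coe] at h2
      rw [hj]
      refine (pow_dvd_pow _ ?_).mul_right u
      by_contra! hjK
      have h3 : μ * j ≤ μ * K := Nat.mul_le_mul_left _ hjK.le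
      rw [nsmul_eq_mul] at h2
      have h4 : (μ : ℤ) * j ≤ μ * K := by exact_mod_cast h3
      push_cast at h2
      have h5 := Int.le_natAbs (a := κ)
      push_cast at h5
      linarith
    refine ⟨c, ?_, fun K => ?_⟩
    · obtain ⟨n, hnp, hnc, -⟩ := key 1
      rw [pow_one] at hnc
      simpa using hnp.sub hnc
    · obtain ⟨n, -, h⟩ := key K
      exact ⟨n, h⟩

/-! ### Vanishing sums of conjugates twisted by roots of unity -/

section Algebra
open Polynomial

theorem exists_real_root {b : ℝ} (hb : 1 ≤ b) (hb' : b ≤ 2) :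
    ∃ r : ℝ, 2 < r ∧ r < 3 ∧ r ^ 3 - 2 * r ^ 2 - b * r - 1 = 0 := by
  have hc : ContinuousOn (fun r : ℝ => r ^ 3 - 2 * r ^ 2 - b * r - 1) (Set.Icc 2 3) := by fun_prop
  obtain ⟨r, ⟨h2, h3⟩, hr⟩ := intermediate_value_Ioo (by norm_num : (2 : ℝ) ≤ 3) hc
    (show (0 : ℝ) ∈ _ by constructor <;> norm_num <;> linarith)
  exact ⟨r, h2, h3, hr⟩

/-- The roots of the characteristic polynomial other than the real root are complex conjugate. -/
theorem conj_root {r : ℝ} (h2 : 2 < r) (h3 : r < 3) {β γ : ℂ} (h1 : r + β + γ = 2)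
    (hm : r * β * γ = 1) : (starRingEnd ℂ) β = γ := by
  have hre := congrArg Complex.re h1
  have him := congrArg Complex.im h1
  have mre := congrArg Complex.re hm
  have mim := congrArg Complex.im hm
  simp at hre him mre mim
  have hr0 : r ≠ 0 := by linarith
  have e1 : γ.im = -β.im := by linarith
  rw [e1] at mre mim
  have e2 : r * β.im * (γ.re - β.re) = 0 := by linear_combination mim
  rcases eq_or_ne β.im 0 with h0 | h0
  · exfalso
    have e3 : γ.re = 2 - r - β.re := by linarith
    rw [h0, e3] at mre
    -- Real β, γ would satisfy (2 - r) ^ 2 ≥ 4 β γ = 4 / r, whereas r (r - 2) ^ 2 < 3.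
    nlinarith [sq_nonneg (2 - r - 2 * β.re), mul_pos (sub_pos.2 h2) (sub_pos.2 h3)]
  · have e3 : γ.re = β.re := by
      have := (mul_eq_zero.1 e2).resolve_left (mul_ne_zero hr0 h0)
      linarith
    apply Complex.ext <;> simp [e1, e3]

/-- Two complex numbers of equal modulus with nonzero real sum are conjugate. Applied to the last
two terms, this makes z' the conjugate of z. -/
theorem mul_eq_one_of_add_eq_zero {y : ℝ} (hy : y ≠ 0) {w z z' : ℂ} (hz : ‖z‖ = 1) (hz' : ‖z'‖ = 1)
    (h : y + w * z + (starRingEnd ℂ) w * z' = 0) : z * z' = 1 := by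
  set P := w * z with hP
  set S := (starRingEnd ℂ) w * z' with hS
  have hn : Complex.normSq P = Complex.normSq S := by
    rw [Complex.normSq_eq_norm_sq, Complex.normSq_eq_norm_sq, hP, hS, norm_mul, norm_mul, hz, hz',
      Complex.norm_conj]
  have hre := congrArg Complex.re h
  have him := congrArg Complex.im h
  simp only [Complex.add_re, Complex.add_im, Complex.ofReal_re, Complex.ofReal_im,
    Complex.zero_re, Complex.zero_im, zero_add] at hre him
  rw [Complex.normSq_apply, Complex.normSq_apply] at hn
  have e1 : S.im = -P.im := by linarith
  have e2 : (P.re - S.re) * (P.re + S.re) = 0 := by rw [e1] at hn; linear_combination hn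
  have e3 : P.re + S.re ≠ 0 := fun h0 => hy (by linarith)
  have e4 : S.re = P.re := by
    have := (mul_eq_zero.1 e2).resolve_right e3
    linarith
  have e5 : S = (starRingEnd ℂ) P := by apply Complex.ext <;> simp [e1, e4]
  have hw : (starRingEnd ℂ) w ≠ 0 := by
    intro h0
    rw [h0, zero_mul] at hS
    rw [hS] at e4
    apply e3
    rw [← e4, hS]
    simp
  have e6 : z' = (starRingEnd ℂ) z := by
    apply mul_left_cancel₀ hw
    rw [← hS, e5, hP, map_mul]
  rw [e6, Complex.mul_conj, Complex.normSq_eq_norm_sq, hz]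
  norm_num

/-- The characteristic polynomial `X ^ 3 - 2 X ^ 2 - b X - 1` over the rational numbers. -/
noncomputable def charPoly (b : ℕ) : ℚ[X] := X ^ 3 - 2 * X ^ 2 - (b : ℚ[X]) * X - 1

theorem charPoly_natDegree (b : ℕ) : (charPoly b).natDegree = 3 := by
  unfold charPoly
  rw [← map_natCast C b]
  compute_degree!

theorem charPoly_monic (b : ℕ) : (charPoly b).Monic := by
  unfold charPoly
  rw [← map_natCast C b]
  monicity!

/-- A reducible cubic has a rational root; here it would be an integer dividing 1. -/
theorem charPoly_irreducible {b : ℕ} (hb : b = 1 ∨ b = 2) : Irreducible (charPoly b) := by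
  rw [(charPoly_monic b).irreducible_iff_roots_eq_zero_of_degree_le_three
    (by rw [charPoly_natDegree]; norm_num) (by rw [charPoly_natDegree])]
  rw [Multiset.eq_zero_iff_forall_notMem]
  intro x hx
  have h0 := (mem_roots'.1 hx).2
  have h1 : x ^ 3 - 2 * x ^ 2 - b * x - 1 = 0 := by simpa [charPoly] using h0
  obtain ⟨m, rfl⟩ : ∃ m : ℤ, x = m := by
    have : IsIntegral ℤ x :=
      ⟨X ^ 3 - 2 * X ^ 2 - (b : ℤ[X]) * X - 1, by rw [← map_natCast C b]; monicity!,
        by simpa using h1⟩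
    obtain ⟨m, hm⟩ := IsIntegrallyClosed.isIntegral_iff.1 this
    exact ⟨m, hm.symm⟩
  have h2 : m ^ 3 - 2 * m ^ 2 - b * m - 1 = 0 := by exact_mod_cast h1
  have h3 : m * (m ^ 2 - 2 * m - b) = 1 := by linear_combination h2
  rcases Int.eq_one_or_neg_one_of_mul_eq_one h3 with rfl | rfl <;> rcases hb with rfl | rfl <;>
    norm_num at h2

/-- If `α₁, α₂, α₃` are the roots of the characteristic polynomial and roots of unity
`ω₁, ω₂, ω₃` give a vanishing sum of conjugates, then `ω₂ ω₃ = ω₁ ^ 2`. -/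
theorem mul_eq_sq_of_sum_eq_zero_of_isAlgebraic {K : Type*} [Field K] [CharZero K]
    [Algebra.IsAlgebraic ℚ K] {b : ℕ} (hb : b = 1 ∨ b = 2) {α₁ α₂ α₃ ω₁ ω₂ ω₃ : K}
    (hα : aeval α₁ (charPoly b) = 0) (h1 : α₁ + α₂ + α₃ = 2) (h3 : α₁ * α₂ * α₃ = 1)
    {N : ℕ} (hN : 0 < N) (hω₁ : ω₁ ^ N = 1) (hω₂ : ω₂ ^ N = 1) (hω₃ : ω₃ ^ N = 1) {u v w : ℚ}
    (hy : u + v * α₁ + w * α₁ ^ 2 ≠ 0)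
    (hs : (u + v * α₁ + w * α₁ ^ 2) * ω₁ + (u + v * α₂ + w * α₂ ^ 2) * ω₂
      + (u + v * α₃ + w * α₃ ^ 2) * ω₃ = 0) :
    ω₂ * ω₃ = ω₁ ^ 2 := by
  have hmin : minpoly ℚ α₁ = charPoly b :=
    (minpoly.eq_of_irreducible_of_monic (charPoly_irreducible hb) hα (charPoly_monic b)).symm
  obtain ⟨r, hr2, hr3, hr⟩ := exists_real_root (b := b)
    (by rcases hb with rfl | rfl <;> norm_num) (by rcases hb with rfl | rfl <;> norm_num)
  -- By irreducibility every complex root is the image of α₁ under some embedding; the real one is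
  -- chosen.
  obtain ⟨φ, hφ⟩ : ∃ φ : K →ₐ[ℚ] ℂ, φ α₁ = r := by
    have : (r : ℂ) ∈ (minpoly ℚ α₁).rootSet ℂ := by
      rw [hmin, mem_rootSet]
      refine ⟨(charPoly_monic b).ne_zero, ?_⟩
      simp only [charPoly, map_sub, map_mul, map_pow, aeval_X, map_one, map_natCast, map_ofNat]
      exact_mod_cast congrArg (algebraMap ℝ ℂ) hr
    rw [← Algebra.IsAlgebraic.range_eval_eq_rootSet_minpoly] at this
    exact this
  have hω₁0 : ω₁ ≠ 0 := by
    rintro rfl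
    simp [hN.ne'] at hω₁
  have hconj : (starRingEnd ℂ) (φ α₂) = φ α₃ := by
    apply conj_root hr2 hr3
    · rw [← hφ, ← map_add, ← map_add, h1, map_ofNat]
    · rw [← hφ, ← map_mul, ← map_mul, h3, map_one]
  have hnorm : ∀ ω : K, ω ^ N = 1 → ‖φ (ω / ω₁)‖ = 1 := by
    intro ω h
    refine Complex.norm_eq_one_of_pow_eq_one (n := N) ?_ hN.ne'
    rw [← map_pow, div_pow, h, hω₁, div_one, map_one]
  have e1 : (starRingEnd ℂ) (φ (u + v * α₂ + w * α₂ ^ 2)) = φ (u + v * α₃ + w * α₃ ^ 2) := by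
    simp only [map_add, map_mul, map_pow, hconj, map_ratCast]
  have e2 : ((u + v * r + w * r ^ 2 : ℝ) : ℂ) = φ (u + v * α₁ + w * α₁ ^ 2) := by
    simp only [map_add, map_mul, map_pow, map_ratCast, hφ]
    push_cast
    rfl
  have key := mul_eq_one_of_add_eq_zero (y := u + v * r + w * r ^ 2)
    (w := φ (u + v * α₂ + w * α₂ ^ 2)) ?_ (hnorm ω₂ hω₂) (hnorm ω₃ hω₃) ?_
  · have key' : φ (ω₂ / ω₁ * (ω₃ / ω₁)) = φ 1 := by rw [map_mul, key, map_one]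
    have := φ.injective key'
    field_simp at this
    exact this
  · intro h0
    apply hy
    apply (map_eq_zero φ).1
    rw [← e2, h0, Complex.ofReal_zero]
  · rw [e1, e2, ← map_mul, ← map_mul, ← map_add, ← map_add, ← map_zero φ]
    congr 1
    field_simp
    linear_combination hs

/-- All elements involved are algebraic over ℚ, so the problem descends to the algebraic closure of
ℚ in F. This is the passage from a p-adic field to ℂ. -/
theorem mul_eq_sq_of_sum_eq_zero {F : Type*} [Field F] [CharZero F]
    {b : ℕ} (hb : b = 1 ∨ b = 2) {α₁ α₂ α₃ ω₁ ω₂ ω₃ : F}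
    (h1 : α₁ + α₂ + α₃ = 2) (h2 : α₁ * α₂ + α₁ * α₃ + α₂ * α₃ = -b) (h3 : α₁ * α₂ * α₃ = 1)
    {N : ℕ} (hN : 0 < N) (hω₁ : ω₁ ^ N = 1) (hω₂ : ω₂ ^ N = 1) (hω₃ : ω₃ ^ N = 1) {u v w : ℚ}
    (hy : u + v * α₁ + w * α₁ ^ 2 ≠ 0)
    (hs : (u + v * α₁ + w * α₁ ^ 2) * ω₁ + (u + v * α₂ + w * α₂ ^ 2) * ω₂
      + (u + v * α₃ + w * α₃ ^ 2) * ω₃ = 0) :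
    ω₂ * ω₃ = ω₁ ^ 2 := by
  have heval : ∀ {K : Type _} [Field K] [CharZero K] (α : K),
      aeval α (charPoly b) = α ^ 3 - 2 * α ^ 2 - b * α - 1 := by
    intro K _ _ α
    simp only [charPoly, map_sub, map_mul, map_pow, aeval_X, map_one, map_natCast, map_ofNat]
  have hroot : ∀ α : F, (α - α₁) * (α - α₂) * (α - α₃) = 0 →
      α ^ 3 - 2 * α ^ 2 - b * α - 1 = 0 := by
    intro α h
    linear_combination h + α ^ 2 * h1 - α * h2 + h3
  have halg : ∀ α : F, (α - α₁) * (α - α₂) * (α - α₃) = 0 → α ∈ algebraicClosure ℚ F :=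
    fun α h => mem_algebraicClosure_iff.2
      ⟨_, (charPoly_monic b).ne_zero, by rw [heval]; exact hroot α h⟩
  have hunit : ∀ ω : F, ω ^ N = 1 → ω ∈ algebraicClosure ℚ F := fun ω h =>
    mem_algebraicClosure_iff.2 ⟨X ^ N - 1, X_pow_sub_C_ne_zero hN 1, by simp [h]⟩
  have hr₁ := hroot α₁ (by ring)
  have : Algebra.IsAlgebraic ℚ (algebraicClosure ℚ F) := by
    have e : (DivisionRing.toRatAlgebra : Algebra ℚ (algebraicClosure ℚ F))
      = (algebraicClosure ℚ F).algebra' := Subsingleton.elim _ _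
    rw [e]
    exact algebraicClosure.isAlgebraic ℚ F
  lift α₁ to algebraicClosure ℚ F using halg _ (by ring)
  lift α₂ to algebraicClosure ℚ F using halg _ (by ring)
  lift α₃ to algebraicClosure ℚ F using halg _ (by ring)
  lift ω₁ to algebraicClosure ℚ F using hunit _ hω₁
  lift ω₂ to algebraicClosure ℚ F using hunit _ hω₂
  lift ω₃ to algebraicClosure ℚ F using hunit _ hω₃
  have := mul_eq_sq_of_sum_eq_zero_of_isAlgebraic (K := algebraicClosure ℚ F) hb (α₁ := α₁)
    (α₂ := α₂) (α₃ := α₃) (ω₁ := ω₁) (ω₂ := ω₂) (ω₃ := ω₃) (u := u) (v := v) (w := w)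
    (by rw [heval]; exact Subtype.val_injective hr₁)
    (Subtype.val_injective h1) (Subtype.val_injective h3) hN (Subtype.val_injective hω₁)
    (Subtype.val_injective hω₂) (Subtype.val_injective hω₃)
    (fun h0 => hy (by simpa using congrArg Subtype.val h0))
    (by apply Subtype.val_injective; simpa using hs)
  exact congrArg Subtype.val this

end Algebra

/-! ### Trace coordinates and exclusion of primitive cube roots of unity -/

/-- The Hankel determinant of five consecutive terms of the sequence starting with `A, B, C`. -/
def hankel (b A B C : ℤ) : ℤ :=
  let D := 2 * C + b * B + A
  let E := 2 * D + b * C + B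
  A * (C * E - D ^ 2) - B * (B * E - C * D) + C * (B * D - C ^ 2)

/-- A shift multiplies the Hankel determinant by that of the companion matrix, which is 1. -/
theorem hankel_recSeq (b n : ℤ) :
    hankel b (recSeq 2 b n) (recSeq 2 b (n + 1)) (recSeq 2 b (n + 2)) = -1 := by
  have hstep : ∀ A B C : ℤ, hankel b B C (2 * C + b * B + A) = hankel b A B C := by
    intro A B C
    simp only [hankel]
    ring
  have h : ∀ n : ℤ, hankel b (recSeq 2 b (n + 1)) (recSeq 2 b (n + 1 + 1)) (recSeq 2 b (n + 1 + 2))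
      = hankel b (recSeq 2 b n) (recSeq 2 b (n + 1)) (recSeq 2 b (n + 2)) := by
    intro n
    rw [show n + 1 + 1 = n + 2 by ring, show n + 1 + 2 = n + 3 by ring, recSeq_add_three, hstep]
  induction n with
  | zero =>
    rw [zero_add, zero_add, recSeq_zero, show recSeq 2 b 1 = 1 from rfl,
      show recSeq 2 b 2 = 2 from rfl]
    simp only [hankel]
    ring
  | succ n ih => rw [h, ih]
  | pred n ih =>
    rw [← h, show -(n : ℤ) - 1 + 1 = -n by ring]
    exact ih

/-- This writes A, B, C as the traces of η, η α, η α ^ 2 with η = u + v α + w α ^ 2. The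
coefficients are power sums of the roots; the system has determinant -87 or -83, the discriminant of
the cubic. -/
theorem exists_trace_coordinates {b : ℕ} (hb : b = 1 ∨ b = 2) (A B C : ℚ) :
    ∃ u v w : ℚ, A = 3 * u + 2 * v + (4 + 2 * b) * w ∧
      B = 2 * u + (4 + 2 * b) * v + (11 + 6 * b) * w ∧
      C = (4 + 2 * b) * u + (11 + 6 * b) * v + (24 + 16 * b + 2 * b ^ 2) * w := by
  rcases hb with rfl | rfl
  · refine ⟨(37 * A - 18 * B + 2 * C) / 87, (-18 * A - 90 * B + 39 * C) / 87,
      (2 * A + 39 * B - 14 * C) / 87, ?_, ?_, ?_⟩ <;> push_cast <;> ring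
  · refine ⟨(17 * A - 56 * B + 18 * C) / 83, (-56 * A - 128 * B + 53 * C) / 83,
      (18 * A + 53 * B - 20 * C) / 83, ?_, ?_, ?_⟩ <;> push_cast <;> ring

/-- A binary quadratic form over `ℚ` whose discriminant is not a square is anisotropic. -/
theorem eq_zero_of_quadratic_eq_zero {q₁ q₂ q₃ v w : ℚ} (hd : ¬ IsSquare (q₂ ^ 2 - 4 * q₁ * q₃))
    (h : q₁ * v ^ 2 + q₂ * v * w + q₃ * w ^ 2 = 0) : v = 0 ∧ w = 0 := by
  have hw : w = 0 := by
    by_contra hw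
    apply hd
    refine ⟨(2 * q₁ * v + q₂ * w) / w, ?_⟩
    field_simp
    linear_combination -4 * q₁ * h
  subst hw
  refine ⟨?_, rfl⟩
  by_contra hv
  have hq : q₁ = 0 := by simpa [hv] using h
  exact hd ⟨q₂, by rw [hq]; ring⟩

theorem not_isSquare_discriminant {b : ℕ} (hb : b = 1 ∨ b = 2) :
    ¬ IsSquare ((25 + 14 * b : ℚ) ^ 2 - 4 * (4 + 3 * b) * (b ^ 2 + 16 * b + 28)) := by
  have h : ∀ n : ℕ, ¬ IsSquare n → ¬ IsSquare (n : ℚ) := fun n hn => by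
    rwa [Rat.isSquare_natCast_iff]
  rcases hb with rfl | rfl
  · convert h 261 (by rintro ⟨k, hk⟩; have : k < 17 := by nlinarith
                      interval_cases k <;> lia) using 2
    norm_num
  · convert h 249 (by rintro ⟨k, hk⟩; have : k < 17 := by nlinarith
                      interval_cases k <;> lia) using 2
    norm_num

/-- Let `A, B, C` be consecutive terms of the sequence and let `r + s X + t X ^ 2` take roots of
unity as values at the roots of the characteristic polynomial. If `A r + B s + C t = 0`, which is a
vanishing sum of Galois conjugates twisted by these roots of unity, then already `A = 0`. -/
theorem eq_zero_of_twisted_sum_eq_zero {F : Type*} [Field F] [CharZero F]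
    {b : ℕ} (hb : b = 1 ∨ b = 2) {α₁ α₂ α₃ r s t : F}
    (h1 : α₁ + α₂ + α₃ = 2) (h2 : α₁ * α₂ + α₁ * α₃ + α₂ * α₃ = -b) (h3 : α₁ * α₂ * α₃ = 1)
    {N : ℕ} (hN : 0 < N) (hω₁ : (r + s * α₁ + t * α₁ ^ 2) ^ N = 1)
    (hω₂ : (r + s * α₂ + t * α₂ ^ 2) ^ N = 1) (hω₃ : (r + s * α₃ + t * α₃ ^ 2) ^ N = 1)
    {A B C : ℤ} (hH : hankel b A B C = -1) (hs : A * r + B * s + C * t = 0) : A = 0 := by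
  obtain ⟨u, v, w, hA, hB, hC⟩ := exists_trace_coordinates hb A B C
  have hroot : ∀ α : F, (α - α₁) * (α - α₂) * (α - α₃) = 0 →
      α ^ 3 = 2 * α ^ 2 + b * α + 1 := by
    intro α h
    linear_combination h + α ^ 2 * h1 - α * h2 + h3
  have r₁ := hroot α₁ (by ring)
  have r₂ := hroot α₂ (by ring)
  have r₃ := hroot α₃ (by ring)
  obtain ⟨y₁, hy₁⟩ : ∃ y : F, y = u + v * α₁ + w * α₁ ^ 2 := ⟨_, rfl⟩
  obtain ⟨y₂, hy₂⟩ : ∃ y : F, y = u + v * α₂ + w * α₂ ^ 2 := ⟨_, rfl⟩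
  obtain ⟨y₃, hy₃⟩ : ∃ y : F, y = u + v * α₃ + w * α₃ ^ 2 := ⟨_, rfl⟩
  have p2 : α₁ ^ 2 + α₂ ^ 2 + α₃ ^ 2 = 4 + 2 * b := by
    linear_combination (α₁ + α₂ + α₃ + 2) * h1 - 2 * h2
  have p3 : α₁ ^ 3 + α₂ ^ 3 + α₃ ^ 3 = 11 + 6 * b := by
    linear_combination r₁ + r₂ + r₃ + 2 * p2 + b * h1
  have p4 : α₁ ^ 4 + α₂ ^ 4 + α₃ ^ 4 = 24 + 16 * b + 2 * b ^ 2 := by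
    linear_combination α₁ * r₁ + α₂ * r₂ + α₃ * r₃ + 2 * p3 + b * p2 + h1
  have hA' : (A : F) = y₁ + y₂ + y₃ := by
    have : (A : F) = 3 * u + 2 * v + (4 + 2 * b) * w := by
      exact_mod_cast congrArg (Rat.cast (K := F)) hA
    rw [hy₁, hy₂, hy₃]
    linear_combination this - v * h1 - w * p2
  have hB' : (B : F) = y₁ * α₁ + y₂ * α₂ + y₃ * α₃ := by
    have : (B : F) = 2 * u + (4 + 2 * b) * v + (11 + 6 * b) * w := by
      exact_mod_cast congrArg (Rat.cast (K := F)) hB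
    rw [hy₁, hy₂, hy₃]
    linear_combination this - u * h1 - v * p2 - w * p3
  have hC' : (C : F) = y₁ * α₁ ^ 2 + y₂ * α₂ ^ 2 + y₃ * α₃ ^ 2 := by
    have : (C : F) = (4 + 2 * b) * u + (11 + 6 * b) * v + (24 + 16 * b + 2 * b ^ 2) * w := by
      exact_mod_cast congrArg (Rat.cast (K := F)) hC
    rw [hy₁, hy₂, hy₃]
    linear_combination this - u * p2 - v * p3 - w * p4
  obtain ⟨ω₁, e₁⟩ : ∃ ω, ω = r + s * α₁ + t * α₁ ^ 2 := ⟨_, rfl⟩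
  obtain ⟨ω₂, e₂⟩ : ∃ ω, ω = r + s * α₂ + t * α₂ ^ 2 := ⟨_, rfl⟩
  obtain ⟨ω₃, e₃⟩ : ∃ ω, ω = r + s * α₃ + t * α₃ ^ 2 := ⟨_, rfl⟩
  rw [← e₁] at hω₁
  rw [← e₂] at hω₂
  rw [← e₃] at hω₃
  replace hs : y₁ * ω₁ + y₂ * ω₂ + y₃ * ω₃ = 0 := by
    rw [hA', hB', hC'] at hs
    rw [e₁, e₂, e₃]
    linear_combination hs
  clear e₁ e₂ e₃
  -- The Hankel determinant factors as y₁ y₂ y₃ times the squared Vandermonde determinant; hence no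
  -- yᵢ vanishes.
  have hprod : y₁ * y₂ * y₃ * ((α₁ - α₂) * (α₁ - α₃) * (α₂ - α₃)) ^ 2 = -1 := by
    obtain ⟨D, hD⟩ : ∃ D : ℤ, D = 2 * C + b * B + A := ⟨_, rfl⟩
    obtain ⟨E, hE⟩ : ∃ E : ℤ, E = 2 * D + b * C + B := ⟨_, rfl⟩
    have hD' : (D : F) = y₁ * α₁ ^ 3 + y₂ * α₂ ^ 3 + y₃ * α₃ ^ 3 := by
      rw [hD]
      push_cast
      rw [hA', hB', hC', r₁, r₂, r₃]
      ring
    have hE' : (E : F) = y₁ * α₁ ^ 4 + y₂ * α₂ ^ 4 + y₃ * α₃ ^ 4 := by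
      rw [hE]
      push_cast
      rw [hB', hC', hD']
      linear_combination -(y₁ * α₁ * r₁ + y₂ * α₂ * r₂ + y₃ * α₃ * r₃)
    simp only [hankel] at hH
    rw [← hD, ← hE] at hH
    have hH' := congrArg (Int.cast (R := F)) hH
    push_cast at hH'
    rw [hA', hB', hC', hD', hE'] at hH'
    linear_combination hH'
  have hy : y₁ ≠ 0 ∧ y₂ ≠ 0 ∧ y₃ ≠ 0 := by
    refine ⟨?_, ?_, ?_⟩ <;> rintro rfl <;> simp at hprod
  have m1 : ω₂ * ω₃ = ω₁ ^ 2 :=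
    mul_eq_sq_of_sum_eq_zero hb h1 h2 h3 hN hω₁ hω₂ hω₃ (hy₁ ▸ hy.1)
      (by rw [← hy₁, ← hy₂, ← hy₃]; exact hs)
  -- Now α₂ takes the role of the real root.
  have m2 : ω₁ * ω₃ = ω₂ ^ 2 :=
    mul_eq_sq_of_sum_eq_zero (α₁ := α₂) (α₂ := α₁) (α₃ := α₃) hb (by linear_combination h1) (by linear_combination h2)
      (by linear_combination h3) hN hω₂ hω₁ hω₃ (hy₂ ▸ hy.2.1) 
      (by rw [← hy₁, ← hy₂, ← hy₃]; linear_combination hs)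
  have hω₁0 : ω₁ ≠ 0 := by rintro rfl; simp [hN.ne'] at hω₁
  obtain ⟨z, rfl⟩ : ∃ z, ω₂ = ω₁ * z := ⟨ω₂ / ω₁, by field_simp⟩
  have hω₃z : ω₃ = ω₁ * z ^ 2 := by
    apply mul_left_cancel₀ hω₁0
    linear_combination m2
  subst hω₃z
  have hz : (z - 1) * (z ^ 2 + z + 1) = 0 := by
    apply mul_left_cancel₀ (pow_ne_zero 2 hω₁0)
    linear_combination m1
  have hs' : y₁ + y₂ * z + y₃ * z ^ 2 = 0 := by
    apply mul_left_cancel₀ hω₁0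
    linear_combination hs
  rcases mul_eq_zero.1 hz with hz | hz
  · have hz : z = 1 := by linear_combination hz
    rw [hz] at hs'
    have : (A : F) = 0 := by linear_combination hA' + hs'
    exact_mod_cast this
  · exfalso
    -- The left side is (y₁ + z y₂ + z ^ 2 y₃)(y₁ + z ^ 2 y₂ + z y₃). Being symmetric in the roots,
    -- it is a rational quadratic form in v and w.
    have hform : y₁ ^ 2 + y₂ ^ 2 + y₃ ^ 2 - y₁ * y₂ - y₁ * y₃ - y₂ * y₃ = 0 := by
      linear_combination (y₁ + z ^ 2 * y₂ + z * y₃) * hs' 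
        + ((1 - z) * (y₂ ^ 2 + y₃ ^ 2) - y₁ * y₂ - y₁ * y₃ - y₂ * y₃ * (z ^ 2 - z + 1)) * hz
    have hform' : (4 + 3 * b) * (v : F) ^ 2 + (25 + 14 * b) * v * w
        + (b ^ 2 + 16 * b + 28) * w ^ 2 = 0 := by
      have e : (v : F) ^ 2 * ((α₁ ^ 2 + α₂ ^ 2 + α₃ ^ 2) - (α₁ * α₂ + α₁ * α₃ + α₂ * α₃))
          + v * w * (3 * (α₁ ^ 3 + α₂ ^ 3 + α₃ ^ 3)
            - (α₁ + α₂ + α₃) * (α₁ ^ 2 + α₂ ^ 2 + α₃ ^ 2))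
          + w ^ 2 * ((α₁ ^ 2 + α₂ ^ 2 + α₃ ^ 2) ^ 2 - 3 * ((α₁ * α₂ + α₁ * α₃ + α₂ * α₃) ^ 2
            - 2 * (α₁ + α₂ + α₃) * (α₁ * α₂ * α₃))) = 0 := by
        rw [← hform, hy₁, hy₂, hy₃]
        ring
      rw [p2, p3, h1, h2, h3] at e
      linear_combination e
    obtain ⟨rfl, rfl⟩ := eq_zero_of_quadratic_eq_zero (v := v) (w := w)
      (not_isSquare_discriminant hb) (by exact_mod_cast hform')
    -- With v = w = 0 the three yᵢ equal the integer m = A - B, and the Hankel determinant is m ^ 3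
    -- times the discriminant, which cannot be -1.
    have hu : u = (A - B : ℤ) := by
      push_cast
      linear_combination hB - hA
    obtain ⟨m, hm⟩ : ∃ m : ℤ, m = A - B := ⟨_, rfl⟩
    rw [← hm] at hu
    subst hu
    have hA3 : A = 3 * m := by
      have : (A : ℚ) = 3 * m := by linear_combination hA
      exact_mod_cast this
    have hB3 : B = 2 * m := by
      have : (B : ℚ) = 2 * m := by linear_combination hB
      exact_mod_cast this
    have hC3 : C = (4 + 2 * b) * m := by
      have : (C : ℚ) = (4 + 2 * b) * m := by linear_combination hC
      exact_mod_cast this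
    rw [hA3, hB3, hC3] at hH
    simp only [hankel] at hH
    rcases hb with rfl | rfl
    · have : (-87) * m ^ 3 = -1 := by push_cast at hH; linear_combination hH
      lia
    · have : (-83) * m ^ 3 = -1 := by push_cast at hH; linear_combination hH
      lia

/-! ### p-adic limits of powers of the companion matrix -/

section Limit
open Filter Topology

theorem tendsto_intCast_zero {p : ℕ} [Fact p.Prime] {d : ℕ → ℤ} (hd : ∀ K, (p : ℤ) ^ K ∣ d K) :
    Tendsto (fun K => (d K : ℤ_[p])) atTop (𝓝 0) := by
  rw [tendsto_zero_iff_norm_tendsto_zero]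
  refine squeeze_zero (fun _ => norm_nonneg _) (fun K => PadicInt.norm_int_le_pow_iff_dvd.2 (hd K)) ?_
  have hp : 1 < (p : ℝ) := by exact_mod_cast (Fact.out : p.Prime).one_lt
  simpa [zpow_neg, inv_pow] using
    tendsto_pow_atTop_nhds_zero_of_lt_one (inv_nonneg.2 (by linarith)) (inv_lt_one_of_one_lt₀ hp)

/-- The companion matrix over the `p`-adic integers. -/
noncomputable def padicCompanion (a b : ℤ) (p : ℕ) [Fact p.Prime] (n : ℤ) :
    Matrix (Fin 3) (Fin 3) ℤ_[p] :=
  (Int.castRingHom ℤ_[p]).mapMatrix ((companion a b) ^ n).val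

/-- Passing to the limit along powers of the companion matrix. -/
theorem IsPeriodMod.exists_limit {a b : ℤ} {p N : ℕ} [Fact p.Prime] (h : IsPeriodMod a b p N)
    (hp2 : p ≠ 2) {c : ℤ} {n : ℕ → ℤ} (hn : ∀ K, (p : ℤ) ^ K ∣ n K - c)
    (hx : ∀ K, (p : ℤ) ^ K ∣ recSeq a b (n K)) :
    ∃ E : Matrix (Fin 3) (Fin 3) ℤ_[p], E ^ N = 1 ∧
      padicCompanion a b p 1 * E = E * padicCompanion a b p 1 ∧
      E 0 0 * recSeq a b c + E 0 1 * recSeq a b (c + 1) + E 0 2 * recSeq a b (c + 2) = 0 := by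
  have : CompactSpace (Matrix (Fin 3) (Fin 3) ℤ_[p]) :=
    inferInstanceAs (CompactSpace (Fin 3 → Fin 3 → ℤ_[p]))
  set e : ℕ → Matrix (Fin 3) (Fin 3) ℤ_[p] := fun K => padicCompanion a b p (n K - c) with he
  -- The powers need not converge; compactness yields a limit along an ultrafilter.
  obtain ⟨E, -, hE⟩ := (isCompact_univ (X := Matrix (Fin 3) (Fin 3) ℤ_[p])).ultrafilter_le_nhds
    ((hyperfilter ℕ).map e) (by simp)
  have hE' : Tendsto e (hyperfilter ℕ : Filter ℕ) (𝓝 E) := hE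
  have hle : (hyperfilter ℕ : Filter ℕ) ≤ atTop := Nat.hyperfilter_le_atTop
  refine ⟨E, ?_, ?_, ?_⟩
  · refine tendsto_nhds_unique (hE'.pow N) (Tendsto.mono_left ?_ hle)
    refine tendsto_pi_nhds.2 fun i => tendsto_pi_nhds.2 fun j => ?_
    obtain ⟨B, hB⟩ := h.exists_zpow_eq Fact.out hp2
    have hd : ∀ K, (p : ℤ) ^ K ∣ ((companion a b) ^ (N * (n K - c))).val i j
        - (1 : Matrix (Fin 3) (Fin 3) ℤ) i j := by
      intro K
      obtain ⟨C, hC⟩ := hB K _ (hn K)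
      obtain ⟨z, hz⟩ := hn K
      rw [hC, hz]
      have e1 : (1 + (p : Matrix (Fin 3) (Fin 3) ℤ) * ((p ^ K * z : ℤ) : Matrix (Fin 3) (Fin 3) ℤ)
          * B + p ^ (K + 2) * C) = 1 + (p ^ K : ℤ) • (((p : ℤ) * z) • B + ((p : ℤ) ^ 2) • C) := by
        simp only [zsmul_eq_mul]
        push_cast
        rw [pow_add]
        have := (Nat.cast_commute p ((p : Matrix (Fin 3) (Fin 3) ℤ) ^ K)).eq
        rw [mul_add, ← mul_assoc, ← mul_assoc, ← mul_assoc, ← mul_assoc, this, add_assoc]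
      rw [e1, Matrix.add_apply, Matrix.smul_apply, add_sub_cancel_left, smul_eq_mul]
      exact dvd_mul_right _ _
    have h1 := (tendsto_intCast_zero hd).add_const ((1 : Matrix (Fin 3) (Fin 3) ℤ_[p]) i j)
    rw [zero_add] at h1
    refine h1.congr fun K => ?_
    have e2 : (e K ^ N) i j = (((companion a b) ^ (N * (n K - c))).val i j : ℤ_[p]) := by
      rw [he]
      simp only [padicCompanion]
      rw [← map_pow, ← Units.val_pow_eq_pow_val, ← zpow_natCast, ← zpow_mul, mul_comm]
      rfl
    rw [e2]
    push_cast
    rw [Matrix.one_apply, Matrix.one_apply]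
    split_ifs <;> simp
  · refine tendsto_nhds_unique (hE'.const_mul _) ((hE'.mul_const _).congr fun K => ?_)
    simp only [he, padicCompanion]
    rw [← map_mul, ← map_mul, ← Units.val_mul, ← Units.val_mul, ← zpow_add, ← zpow_add, add_comm]
  · have hij : ∀ i j, Tendsto (fun K => e K i j) (hyperfilter ℕ : Filter ℕ) (𝓝 (E i j)) :=
      fun i j => tendsto_pi_nhds.1 (tendsto_pi_nhds.1 hE' i) j
    refine tendsto_nhds_unique ((((hij 0 0).mul_const _).add ((hij 0 1).mul_const _)).add
      ((hij 0 2).mul_const _)) (((tendsto_intCast_zero hx).mono_left hle).congr fun K => ?_)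
    have h1 := congrFun (companion_zpow_mulVec_state a b c (n K - c)) 0
    rw [show c + (n K - c) = n K by ring] at h1
    simp only [state, Matrix.mulVec, dotProduct, Fin.sum_univ_three, Matrix.cons_val] at h1
    rw [← h1]
    simp [he, padicCompanion]

end Limit

/-- A matrix commuting with the companion matrix acts on its eigenvector `(1, α, α ^ 2)` through
the value at `α` of the polynomial formed by its first row. -/
theorem eval_pow_eq_one_of_commute {F : Type*} [Field F] {b α : F}
    (hα : α ^ 3 = 2 * α ^ 2 + b * α + 1)
    {E : Matrix (Fin 3) (Fin 3) F}
    (hE : !![0, 1, 0; 0, 0, 1; 1, b, 2] * E = E * !![0, 1, 0; 0, 0, 1; 1, b, 2]) {N : ℕ}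
    (hN : E ^ N = 1) : (E 0 0 + E 0 1 * α + E 0 2 * α ^ 2) ^ N = 1 := by
  have hv : Matrix.mulVec !![0, 1, 0; 0, 0, 1; 1, b, 2] ![1, α, α ^ 2] = α • ![1, α, α ^ 2] := by
    ext i
    fin_cases i
    · simp [Matrix.mulVec, dotProduct, Fin.sum_univ_three]
    · simp [Matrix.mulVec, dotProduct, Fin.sum_univ_three]
      ring
    · simp [Matrix.mulVec, dotProduct, Fin.sum_univ_three]
      linear_combination -hα
  have hEv : E.mulVec ![1, α, α ^ 2] = (E 0 0 + E 0 1 * α + E 0 2 * α ^ 2) • ![1, α, α ^ 2] := by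
    have h1 := congrArg (fun A => A.mulVec ![1, α, α ^ 2]) hE
    simp only [← Matrix.mulVec_mulVec, hv, Matrix.mulVec_smul] at h1
    have h0 : (E.mulVec ![1, α, α ^ 2]) 0 = E 0 0 + E 0 1 * α + E 0 2 * α ^ 2 := by
      simp [Matrix.mulVec, dotProduct, Fin.sum_univ_three]
    rw [← h0]
    generalize E.mulVec ![1, α, α ^ 2] = y at h1
    have h10 := congrFun h1 0
    have h11 := congrFun h1 1
    simp [Matrix.mulVec, dotProduct, Fin.sum_univ_three] at h10 h11
    ext i
    fin_cases i
    · simp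
    · simp [h10, mul_comm]
    · simp [h11, h10]
      ring
  generalize E 0 0 + E 0 1 * α + E 0 2 * α ^ 2 = ω at hEv
  have hpow : ∀ k : ℕ, (E ^ k).mulVec ![1, α, α ^ 2] = ω ^ k • ![1, α, α ^ 2] := by
    intro k
    induction k with
    | zero => simp
    | succ k ih =>
      rw [pow_succ, ← Matrix.mulVec_mulVec, hEv, Matrix.mulVec_smul, ih, smul_smul,
        ← pow_succ' ω]
  have := congrFun (hpow N) 0
  rw [hN, Matrix.one_mulVec] at this
  simpa using this.symm

theorem exists_roots {F : Type*} [Field F] [IsAlgClosed F] (b : F) :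
    ∃ α₁ α₂ α₃ : F, α₁ + α₂ + α₃ = 2 ∧ α₁ * α₂ + α₁ * α₃ + α₂ * α₃ = -b ∧ α₁ * α₂ * α₃ = 1 := by
  open Polynomial in
  have hd : ∀ q : F[X], q.natDegree ≠ 0 → ∃ x, q.IsRoot x := fun q hq =>
    IsAlgClosed.exists_root q fun h => hq (natDegree_eq_of_degree_eq_some h)
  obtain ⟨x, hx⟩ := hd (X ^ 3 - 2 * X ^ 2 - C b * X - 1) (by
    rw [show (X ^ 3 - 2 * X ^ 2 - C b * X - 1 : F[X]).natDegree = 3 by compute_degree!]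
    norm_num)
  -- This quadratic is the quotient of the cubic by X - x.
  obtain ⟨y, hy⟩ := hd (X ^ 2 + C (x - 2) * X + C (x ^ 2 - 2 * x - b)) (by
    rw [show (X ^ 2 + C (x - 2) * X + C (x ^ 2 - 2 * x - b) : F[X]).natDegree = 2 by
      compute_degree!]
    norm_num)
  simp only [IsRoot.def, eval_add, eval_sub, eval_mul, eval_pow, eval_X, eval_C, eval_ofNat,
    eval_one] at hx hy
  refine ⟨x, y, 2 - x - y, by ring, by linear_combination -hy, by linear_combination hx - x * hy⟩

/-- An integer `c` which is a `p`-adic limit of indices of terms tending to `0` `p`-adically is a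
zero of the sequence. -/
theorem IsPeriodMod.eq_zero_of_approx {b p N : ℕ} (hb : b = 1 ∨ b = 2)
    (h : IsPeriodMod 2 b p N) (hp : p.Prime) (hp2 : p ≠ 2) (hN : 0 < N) {c : ℤ}
    (H : ∀ K : ℕ, ∃ n : ℤ, (p : ℤ) ^ K ∣ n - c ∧ (p : ℤ) ^ K ∣ recSeq 2 b n) :
    recSeq 2 b c = 0 := by
  have := Fact.mk hp
  choose n hn hx using H
  obtain ⟨E, hEN, hcomm, hE⟩ := h.exists_limit hp2 hn hx
  let ι : ℤ_[p] →+* AlgebraicClosure ℚ_[p] := (algebraMap ℚ_[p] _).comp PadicInt.Coe.ringHom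
  have : CharZero (AlgebraicClosure ℚ_[p]) := charZero_of_injective_algebraMap
    (algebraMap ℚ_[p] (AlgebraicClosure ℚ_[p])).injective
  obtain ⟨α₁, α₂, α₃, h1, h2, h3⟩ := exists_roots (b : AlgebraicClosure ℚ_[p])
  have hroot : ∀ α, (α - α₁) * (α - α₂) * (α - α₃) = 0 → α ^ 3 = 2 * α ^ 2 + b * α + 1 := by
    intro α h
    linear_combination h + α ^ 2 * h1 - α * h2 + h3
  have hEN' : ι.mapMatrix E ^ N = 1 := by rw [← map_pow, hEN, map_one]
  have hcomm' : !![0, 1, 0; 0, 0, 1; 1, (b : AlgebraicClosure ℚ_[p]), 2] * ι.mapMatrix E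
      = ι.mapMatrix E * !![0, 1, 0; 0, 0, 1; 1, (b : AlgebraicClosure ℚ_[p]), 2] := by
    have e : ι.mapMatrix (padicCompanion 2 b p 1)
        = !![0, 1, 0; 0, 0, 1; 1, (b : AlgebraicClosure ℚ_[p]), 2] := by
      ext i j
      fin_cases i <;> fin_cases j <;> simp [padicCompanion, companion]
      exact map_ofNat ι 2
    rw [← e, ← map_mul, hcomm, map_mul]
  have hω := fun α hα => eval_pow_eq_one_of_commute (α := α) (hroot α hα) hcomm' hEN'
  refine eq_zero_of_twisted_sum_eq_zero hb h1 h2 h3 hN (hω α₁ (by ring)) (hω α₂ (by ring))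
    (hω α₃ (by ring)) (hankel_recSeq b c) ?_
  have := congrArg ι hE
  simp only [map_add, map_mul, map_intCast, map_zero] at this
  simp only [RingHom.mapMatrix_apply, Matrix.map_apply]
  linear_combination this

/-! ### Computing terms of the sequence modulo m -/

section Evaluation
open Polynomial

/-- Multiplication of `r + s X + t X ^ 2` modulo `X ^ 3 - 2 X ^ 2 - b X - 1` and `m`. -/
def mulMod (b m : ℕ) (u v : ℕ × ℕ × ℕ) : ℕ × ℕ × ℕ :=
  let c3 := u.2.1 * v.2.2 + u.2.2 * v.2.1
  let c4 := u.2.2 * v.2.2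
  ((u.1 * v.1 + c3 + 2 * c4) % m,
    (u.1 * v.2.1 + u.2.1 * v.1 + b * c3 + (1 + 2 * b) * c4) % m,
    (u.1 * v.2.2 + u.2.1 * v.2.1 + u.2.2 * v.1 + 2 * c3 + (4 + b) * c4) % m)

/-- The coefficients of `X ^ n` modulo `X ^ 3 - 2 X ^ 2 - b X - 1` and `m`, by repeated squaring,
for `n < 2 ^ fuel`. -/
def powMod (b m : ℕ) : ℕ → ℕ → ℕ × ℕ × ℕ
  | 0, _ => (1, 0, 0)
  | fuel + 1, n =>
    let h := powMod b m fuel (n / 2)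
    let q := mulMod b m h h
    if n % 2 = 0 then q else mulMod b m q (0, 1, 0)

/-- The term `x_n` of the sequence modulo `m`, for `n < 2 ^ 24`. -/
def termMod (b m n : ℕ) : ℕ :=
  let u := powMod b m 24 n
  (u.2.1 + 2 * u.2.2) % m

/-- `X ^ n` is congruent to the polynomial with coefficients `u`. -/
def Represents (b m n : ℕ) (u : ℕ × ℕ × ℕ) : Prop :=
  ∃ g h : ℤ[X], (X : ℤ[X]) ^ n = (u.1 : ℤ[X]) + (u.2.1 : ℤ[X]) * X + (u.2.2 : ℤ[X]) * X ^ 2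
    + (X ^ 3 - 2 * X ^ 2 - (b : ℤ[X]) * X - 1) * g + (m : ℤ[X]) * h

theorem natCast_eq_mod_add (R : Type*) [CommRing R] (r m : ℕ) :
    (r : R) = ((r % m : ℕ) : R) + m * ((r / m : ℕ) : R) := by
  exact_mod_cast congrArg (Nat.cast (R := R)) (Nat.mod_add_div r m).symm

theorem Represents.mul {b m n k : ℕ} {u v : ℕ × ℕ × ℕ} (hu : Represents b m n u)
    (hv : Represents b m k v) : Represents b m (n + k) (mulMod b m u v) := by
  obtain ⟨g, h, hu⟩ := hu
  obtain ⟨g', h', hv⟩ := hv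
  obtain ⟨r, s, t⟩ := u
  obtain ⟨r', s', t'⟩ := v
  have e0 := natCast_eq_mod_add ℤ[X] (r * r' + (s * t' + t * s') + 2 * (t * t')) m
  have e1 := natCast_eq_mod_add ℤ[X]
    (r * s' + s * r' + b * (s * t' + t * s') + (1 + 2 * b) * (t * t')) m
  have e2 := natCast_eq_mod_add ℤ[X]
    (r * t' + s * s' + t * r' + 2 * (s * t' + t * s') + (4 + b) * (t * t')) m
  generalize (r * r' + (s * t' + t * s') + 2 * (t * t')) / m = q0 at e0
  generalize (r * s' + s * r' + b * (s * t' + t * s') + (1 + 2 * b) * (t * t')) / m = q1 at e1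
  generalize (r * t' + s * s' + t * r' + 2 * (s * t' + t * s') + (4 + b) * (t * t')) / m = q2 at e2
  simp only [Represents, mulMod]
  generalize (r * r' + (s * t' + t * s') + 2 * (t * t')) % m = r0 at *
  generalize (r * s' + s * r' + b * (s * t' + t * s') + (1 + 2 * b) * (t * t')) % m = r1 at *
  generalize (r * t' + s * s' + t * r' + 2 * (s * t' + t * s') + (4 + b) * (t * t')) % m = r2 at *
  simp only at hu hv
  push_cast at e0 e1 e2
  generalize (r : ℤ[X]) = r, (s : ℤ[X]) = s, (t : ℤ[X]) = t, (r' : ℤ[X]) = r', (s' : ℤ[X]) = s',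
    (t' : ℤ[X]) = t', (b : ℤ[X]) = b, (m : ℤ[X]) = m, (q0 : ℤ[X]) = q0, (q1 : ℤ[X]) = q1,
    (q2 : ℤ[X]) = q2 at *
  -- Dividing X ^ 3 and X ^ 4 by the characteristic polynomial leaves quotients 1 and X + 2; q0, q1,
  -- q2 are the quotients by m.
  refine ⟨(s * t' + t * s') + t * t' * (X + 2) + g * (r' + s' * X + t' * X ^ 2
    + (X ^ 3 - 2 * X ^ 2 - b * X - 1) * g' + m * h') + (r + s * X + t * X ^ 2 + m * h) * g',
    q0 + q1 * X + q2 * X ^ 2 + h * (r' + s' * X + t' * X ^ 2 + m * h')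
    + (r + s * X + t * X ^ 2) * h', ?_⟩
  rw [pow_add, hu, hv]
  linear_combination e0 + X * e1 + X ^ 2 * e2

theorem represents_powMod (b m fuel n : ℕ) (hn : n < 2 ^ fuel) :
    Represents b m n (powMod b m fuel n) := by
  induction fuel generalizing n with
  | zero =>
    obtain rfl : n = 0 := by simpa using hn
    exact ⟨0, 0, by simp [powMod]⟩
  | succ fuel ih =>
    have h := ih (n / 2) (by rw [pow_succ] at hn; lia)
    have h2 := h.mul h
    rw [powMod]
    split_ifs with h0
    · rwa [show n / 2 + n / 2 = n by lia] at h2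
    · have h3 := h2.mul (⟨0, 0, by simp⟩ : Represents b m 1 (0, 1, 0))
      rwa [show n / 2 + n / 2 + 1 = n by lia] at h3

/-- The congruence is evaluated at the companion matrix, where Cayley–Hamilton removes the multiple
of the characteristic polynomial. -/
theorem Represents.companion_pow_eq {b m n : ℕ} {u : ℕ × ℕ × ℕ} (h : Represents b m n u) :
    ∃ B : Matrix (Fin 3) (Fin 3) ℤ, ((companion 2 b) ^ n).val =
      u.1 + u.2.1 * (companion 2 b).val + u.2.2 * (companion 2 b).val ^ 2 + m * B := by
  obtain ⟨g, h, hu⟩ := h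
  refine ⟨aeval (companion 2 b).val h, ?_⟩
  have h0 : (companion 2 b).val ^ 3 - 2 * (companion 2 b).val ^ 2 - b * (companion 2 b).val - 1
      = 0 := by
    rw [sub_sub, sub_sub, sub_eq_zero]
    ext i j
    have e1 : (b : Matrix (Fin 3) (Fin 3) ℤ) = Matrix.diagonal fun _ => (b : ℤ) :=
      (Matrix.diagonal_natCast b).symm
    have e2 : (2 : Matrix (Fin 3) (Fin 3) ℤ) = Matrix.diagonal fun _ => (2 : ℤ) :=
      (Matrix.diagonal_ofNat 2).symm
    rw [e1, e2]
    fin_cases i <;> fin_cases j <;>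
      simp [companion, pow_succ, Matrix.mul_apply, Fin.sum_univ_three] <;> ring
  have := congrArg (aeval (companion 2 b).val) hu
  simp only [map_add, map_mul, map_sub, map_pow, aeval_X, map_one, map_natCast, map_ofNat, h0,
    zero_mul, add_zero] at this
  rw [Units.val_pow_eq_pow_val, this]

theorem isPeriodMod_of_powMod {b p N : ℕ} (hN : N < 2 ^ 24) (h : powMod b p 24 N = (1, 0, 0)) :
    IsPeriodMod 2 b p N := by
  obtain ⟨B, hB⟩ := (represents_powMod b p 24 N hN).companion_pow_eq
  refine ⟨B, ?_⟩
  rw [hB, h]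
  simp

/-- Applied to the initial state (0, 1, 2), r + s U + t U ^ 2 has first entry s + 2 t. -/
theorem dvd_recSeq_iff {b m n : ℕ} (hn : n < 2 ^ 24) :
    (m : ℤ) ∣ recSeq 2 b n ↔ termMod b m n = 0 := by
  obtain ⟨B, hB⟩ := (represents_powMod b m 24 n hn).companion_pow_eq
  have h1 := congrFun (companion_zpow_mulVec_state 2 b 0 n) 0
  rw [termMod]
  generalize powMod b m 24 n = u at *
  obtain ⟨r, s, t⟩ := u
  simp only at hB ⊢
  have e1 : (m * B) = (m : ℤ) • B := by rw [zsmul_eq_mul]; push_cast; rfl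
  have e2 (c : ℕ) (A : Matrix (Fin 3) (Fin 3) ℤ) : (c * A) = (c : ℤ) • A := by
    rw [zsmul_eq_mul]; push_cast; rfl
  have e3 : (r : Matrix (Fin 3) (Fin 3) ℤ) = (r : ℤ) • 1 := by rw [zsmul_eq_mul]; simp
  rw [zpow_natCast, hB, e2, e2, e2, e3, Matrix.add_mulVec, Matrix.add_mulVec, Matrix.add_mulVec,
    Matrix.smul_mulVec, Matrix.smul_mulVec, Matrix.smul_mulVec, Matrix.smul_mulVec, pow_two,
    ← Matrix.mulVec_mulVec, companion_mulVec_state, companion_mulVec_state, Matrix.one_mulVec] at h1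
  simp only [state, Pi.add_apply, Pi.smul_apply, smul_eq_mul, Matrix.cons_val_zero, zero_add,
    recSeq_zero, mul_zero] at h1
  rw [show recSeq 2 (b : ℤ) 1 = 1 from rfl, show recSeq 2 (b : ℤ) (1 + 1) = 2 from rfl] at h1
  rw [← h1, ← Nat.dvd_iff_mod_eq_zero, ← Int.natCast_dvd_natCast, dvd_add_left (dvd_mul_right _ _)]
  push_cast
  rw [mul_one, mul_comm (t : ℤ)]

end Evaluation

/-! ### Numerical certificates and conclusion -/

/-- A period `N` modulo `p`, together with a simple zero `l` modulo `p ^ 2` that is not congruent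
modulo `p` to either of the two integer zeros. -/
def IsNontrivialZero (b : ℕ) (d : ℕ × ℕ × ℕ) : Prop :=
  0 < d.2.1 ∧ d.2.1 < 2 ^ 24 ∧ d.2.2 + d.2.1 < 2 ^ 24 ∧ powMod b d.1 24 d.2.1 = (1, 0, 0) ∧
    termMod b (d.1 ^ 2) d.2.2 = 0 ∧ termMod b (d.1 ^ 2) (d.2.2 + d.2.1) ≠ 0 ∧
    d.2.2 % d.1 ≠ 0 ∧ (d.2.2 + 1) % d.1 ≠ 0

instance (b : ℕ) : DecidablePred (IsNontrivialZero b) := fun d => by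
  unfold IsNontrivialZero; infer_instance

/-- The conjecture would produce an integer zero congruent to l modulo p, but 0 and -1 are excluded
by the certificate. -/
theorem IsNontrivialZero.not_conjectureHolds {b : ℕ} (hb : b = 1 ∨ b = 2)
    (hz : ∀ n : ℤ, recSeq 2 b n = 0 → n = 0 ∨ n = -1) {p N l : ℕ}
    (h : IsNontrivialZero b (p, N, l)) (hp : p.Prime) (hp2 : p ≠ 2) :
    ¬ ConjectureHolds (recSeq 2 b) p := by
  obtain ⟨hN0, hN, hlN, hper, hl, hl2, h0, h1⟩ := h
  simp only at hN0 hN hlN hper hl hl2 h0 h1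
  intro hC
  have hP := isPeriodMod_of_powMod hN hper
  have hl' : (p : ℤ) ^ 2 ∣ recSeq 2 b l := by
    exact_mod_cast (dvd_recSeq_iff (by lia)).2 hl
  have hl2' : ¬ (p : ℤ) ^ 2 ∣ recSeq 2 b (l + N) := by
    intro h
    apply hl2
    rw [← dvd_recSeq_iff hlN]
    exact_mod_cast h
  obtain ⟨c, hcl, hc⟩ := hP.exists_int_of_conjectureHolds hp hp2 hl' hl2' hC
  have hc0 := hP.eq_zero_of_approx hb hp hp2 hN0 hc
  rcases hz c hc0 with rfl | rfl
  · rw [zero_sub, dvd_neg, Int.natCast_dvd_natCast] at hcl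
    exact h0 (Nat.mod_eq_zero_of_dvd hcl)
  · rw [← dvd_neg, neg_sub, sub_neg_eq_add] at hcl
    exact h1 (Nat.mod_eq_zero_of_dvd (by exact_mod_cast hcl))

/-- Decidable form of the conditions in `OnlyTrivialZeros`. -/
def OnlyTrivialZerosMod (b p N : ℕ) : Prop :=
  0 < N ∧ N < 2 ^ 24 ∧ powMod b p 24 N = (1, 0, 0) ∧ N % p ≠ 0 ∧ termMod b (p ^ 2) N ≠ 0 ∧
    termMod b (p ^ 2) (N - 1) ≠ 0 ∧ ∀ i < N, i = 0 ∨ i + 1 = N ∨ termMod b p i ≠ 0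

instance (b p N : ℕ) : Decidable (OnlyTrivialZerosMod b p N) := by
  unfold OnlyTrivialZerosMod; infer_instance

theorem OnlyTrivialZerosMod.onlyTrivialZeros {b p N : ℕ} (h : OnlyTrivialZerosMod b p N)
    (hp : p.Prime) (hp2 : p ≠ 2) : OnlyTrivialZeros b p N := by
  obtain ⟨hN0, hN, hper, hpN, h0, h1, hi⟩ := h
  refine ⟨hp, hp2, isPeriodMod_of_powMod hN hper, fun h => hpN (Nat.mod_eq_zero_of_dvd h),
    fun h => h0 ?_, fun h => h1 ?_, fun i hiN => ?_⟩
  · rw [← dvd_recSeq_iff hN]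
    simpa using h
  · rw [← dvd_recSeq_iff (by lia)]
    push_cast [Nat.cast_sub hN0]
    rwa [neg_add_eq_sub] at h
  · rw [dvd_recSeq_iff (hiN.trans hN)]
    exact hi i hiN

/-- Nontrivial zeros of the Tripell sequence for the primes in question. -/
def tripellZeros : List (ℕ × ℕ × ℕ) :=
  [(7, 57, 120), (11, 19, 119), (13, 61, 614), (17, 307, 677), (23, 528, 1600), (31, 320, 7386),
    (37, 1368, 43817), (43, 231, 3037), (47, 2257, 81267), (53, 2808, 115166), (59, 435, 17038),
    (61, 744, 10476), (67, 4557, 31915), (71, 5040, 70580), (73, 1776, 19681),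
    (79, 6240, 106156), (83, 3444, 6988), (89, 8011, 88148), (97, 3136, 282261),
    (101, 10303, 298797), (107, 11448, 995983), (109, 11991, 71954), (113, 12883, 12918),
    (127, 1008, 29492), (131, 17293, 432564), (139, 19461, 467087), (149, 11100, 355378),
    (157, 6162, 560780), (163, 1476, 162483), (167, 4648, 437046), (173, 1247, 169731),
    (179, 32040, 2467216), (181, 32943, 5007847), (193, 18624, 2701101), (197, 38808, 6131730),
    (199, 39801, 4617121), (211, 7420, 341374), (223, 49953, 8392653), (227, 25764, 2344588),
    (229, 52440, 5663656), (233, 9048, 1999706), (239, 57120, 742592), (241, 58323, 6299140)]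

/-- Nontrivial zeros of the modified Tripell sequence for the primes in question. -/
def modifiedTripellZeros : List (ℕ × ℕ × ℕ) :=
  [(11, 133, 805), (13, 168, 1199), (17, 307, 2767), (19, 360, 395), (29, 67, 1621),
    (31, 993, 21883), (37, 1407, 22567), (43, 924, 7405), (47, 2208, 84108), (53, 702, 18265),
    (59, 3541, 81494), (61, 1261, 1284), (67, 2244, 15828), (71, 2520, 95934),
    (73, 5328, 330363), (79, 2080, 91569), (89, 660, 15236), (97, 4704, 362242),
    (101, 1020, 44915), (103, 1326, 91517), (107, 2862, 63024), (109, 11991, 1247072),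
    (113, 12883, 554053), (127, 16257, 1820812), (137, 9384, 150162), (139, 19320, 2570017),
    (149, 5550, 666033), (151, 22953, 803526), (157, 24648, 1947906), (163, 8856, 150598),
    (167, 28057, 954094), (173, 30103, 4575687), (179, 10680, 1848130), (181, 32760, 819107),
    (191, 36673, 1027206), (197, 39007, 4290854), (199, 198, 6654), (211, 14840, 2537659),
    (223, 7104, 547046), (229, 228, 4079), (233, 54288, 1031557), (239, 14280, 2099778),
    (241, 58323, 12189627)]

theorem tripellZeros_spec : ∀ d ∈ tripellZeros, IsNontrivialZero 1 d := by decide +kernel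

theorem modifiedTripellZeros_spec : ∀ d ∈ modifiedTripellZeros, IsNontrivialZero 2 d := by
  decide +kernel

/-- Because 251 < 17 ^ 2, trial division by the primes up to 13 characterizes primality in this
range. -/
theorem mem_tripellZeros : ∀ p < 251, (5 ≤ p ∧ (∀ q ∈ [2, 3, 5, 7, 11, 13], ¬ q ∣ p ∨ q = p) ∧
    p ∉ [5, 19, 29, 41, 103, 137, 151, 191]) → p ∈ tripellZeros.map Prod.fst := by
  decide +kernel

theorem mem_modifiedTripellZeros :
    ∀ p < 251, (5 ≤ p ∧ (∀ q ∈ [2, 3, 5, 7, 11, 13], ¬ q ∣ p ∨ q = p) ∧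
    p ∉ [5, 7, 23, 41, 83, 131, 193, 227]) → p ∈ modifiedTripellZeros.map Prod.fst := by
  decide +kernel

theorem tripell_onlyTrivialZerosMod :
    ∀ d ∈ [(103, 102), (137, 136), (191, 95)], OnlyTrivialZerosMod 1 d.1 d.2 := by
  decide +kernel

theorem modifiedTripell_onlyTrivialZerosMod :
    ∀ d ∈ [(5, 8), (23, 22), (41, 40), (131, 130), (193, 192), (227, 113)],
      OnlyTrivialZerosMod 2 d.1 d.2 := by
  decide +kernel

theorem not_conjectureHolds_of_mem {b : ℕ} (hb : b = 1 ∨ b = 2)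
    (hz : ∀ n : ℤ, recSeq 2 b n = 0 → n = 0 ∨ n = -1) {L : List (ℕ × ℕ × ℕ)}
    (hL : ∀ d ∈ L, IsNontrivialZero b d) {p : ℕ} (hp : p.Prime) (h5 : 5 ≤ p)
    (hpL : p ∈ L.map Prod.fst) : ¬ ConjectureHolds (recSeq 2 b) p := by
  obtain ⟨⟨_, N, l⟩, hd, rfl⟩ := List.mem_map.1 hpL
  exact (hL _ hd).not_conjectureHolds hb hz hp (by rintro h; simp only at h5 h; lia)

theorem Nat.Prime.not_dvd_or_eq_of_mem {p : ℕ} (hp : p.Prime) :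
    ∀ q ∈ [2, 3, 5, 7, 11, 13], ¬ q ∣ p ∨ q = p := by
  intro q hq
  by_contra! h
  obtain ⟨hqp, hne⟩ := h
  obtain rfl := (hp.eq_one_or_self_of_dvd q hqp).resolve_right hne
  simp at hq

theorem tripell_onlyTrivialZeros {p N : ℕ} (hd : (p, N) ∈ [(103, 102), (137, 136), (191, 95)]) :
    OnlyTrivialZeros 1 p N := by
  have h := tripell_onlyTrivialZerosMod _ hd
  simp only [List.mem_cons, Prod.mk.injEq, List.not_mem_nil, or_false] at hd
  rcases hd with ⟨rfl, rfl⟩ | ⟨rfl, rfl⟩ | ⟨rfl, rfl⟩ <;>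
    exact h.onlyTrivialZeros (by norm_num) (by norm_num)

theorem modifiedTripell_onlyTrivialZeros {p N : ℕ}
    (hd : (p, N) ∈ [(5, 8), (23, 22), (41, 40), (131, 130), (193, 192), (227, 113)]) :
    OnlyTrivialZeros 2 p N := by
  have h := modifiedTripell_onlyTrivialZerosMod _ hd
  simp only [List.mem_cons, Prod.mk.injEq, List.not_mem_nil, or_false] at hd
  rcases hd with ⟨rfl, rfl⟩ | ⟨rfl, rfl⟩ | ⟨rfl, rfl⟩ | ⟨rfl, rfl⟩ | ⟨rfl, rfl⟩ | ⟨rfl, rfl⟩ <;>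
    exact h.onlyTrivialZeros (by norm_num) (by norm_num)

end ThirdOrder

theorem theorem1p5 :
    ((∀ p : ℕ, p.Prime → 5 ≤ p → p ≤ 250 →
        p ∉ ({5, 19, 29, 41, 103, 137, 151, 191} : Finset ℕ) →
        ¬ ThirdOrder.ConjectureHolds ThirdOrder.tripell p) ∧
      (∀ p ∈ ({103, 137, 191} : Finset ℕ),
        ThirdOrder.ConjectureHolds ThirdOrder.tripell p)) ∧
    ((∀ p : ℕ, p.Prime → 5 ≤ p → p ≤ 250 →
        p ∉ ({5, 7, 23, 41, 83, 131, 193, 227} : Finset ℕ) →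
        ¬ ThirdOrder.ConjectureHolds ThirdOrder.modifiedTripell p) ∧
      (∀ p ∈ ({5, 23, 41, 131, 193, 227} : Finset ℕ),
        ThirdOrder.ConjectureHolds ThirdOrder.modifiedTripell p)) := by
  open ThirdOrder in
  refine ⟨⟨fun p hp h5 h250 hex => ?_, fun p hp => ?_⟩, fun p hp h5 h250 hex => ?_, fun p hp => ?_⟩
  · exact not_conjectureHolds_of_mem (b := 1) (.inl rfl)
      -- The prime 103 determines all integer zeros, for use at every other p.
      (fun n hn => (tripell_onlyTrivialZeros (p := 103) (N := 102) (by simp)).eq_of_eq_zero hn)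
      tripellZeros_spec hp h5 (mem_tripellZeros p (by lia)
        ⟨h5, hp.not_dvd_or_eq_of_mem, by simpa using hex⟩)
  · have : ∃ N, (p, N) ∈ [(103, 102), (137, 136), (191, 95)] := by
      simp only [Finset.mem_insert, Finset.mem_singleton] at hp
      rcases hp with rfl | rfl | rfl <;> simp
    obtain ⟨N, hN⟩ := this
    exact (tripell_onlyTrivialZeros hN).conjectureHolds
  · exact not_conjectureHolds_of_mem (b := 2) (.inr rfl)
      (fun n hn => (modifiedTripell_onlyTrivialZeros (p := 5) (N := 8) (by simp)).eq_of_eq_zero hn)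
      modifiedTripellZeros_spec hp h5 (mem_modifiedTripellZeros p (by lia)
        ⟨h5, hp.not_dvd_or_eq_of_mem, by simpa using hex⟩)
  · have : ∃ N, (p, N) ∈ [(5, 8), (23, 22), (41, 40), (131, 130), (193, 192), (227, 113)] := by
      simp only [Finset.mem_insert, Finset.mem_singleton] at hp
      rcases hp with rfl | rfl | rfl | rfl | rfl | rfl <;> simp
    obtain ⟨N, hN⟩ := this
    exact (modifiedTripell_onlyTrivialZeros hN).conjectureHolds
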